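/- For $\alpha,\nu\in\mathbb{C}$ let $W_{\alpha,\nu}:(0,\infty)\to\mathbb{C}$ be the Whittaker function, i.e. the unique solution on $(0,\infty)$ of \[ u''(x)+\Bigl(-\tfrac14+\frac{\alpha}{x}+\frac{\frac14-\nu^2}{x^2}\Bigr)u(x)=0 \qquad\text{with}\qquad u(x)\sim x^{\alpha}e^{-x/2}\quad(x\to\infty). \] For $x,z>0$ and $a,b,\mu\in\mathbb{C}$ let \[ \Psi(a,b;x)=e^{x/2}x^{-b/2}\,W_{\frac b2-a,\frac b2-\frac12}(x),\qquad D_\mu(z)=2^{\frac\mu2+\frac14}z^{-\frac12}\,W_{\frac\mu2+\frac14,\frac14}\bigl(\tfrac{z^2}{2}\bigr) \] be the confluent hypergeometric function of the second kind and the parabolic cylinder function. For $a\in\mathbb{C}$ and $x,y,\xi>0$ put $\mathrm{m}_a(\xi)=\xi^{-2a-1}e^{-\xi}$ and \[ q_a(x,y,\xi)=2^{-\frac32+a}\pi^{-\frac12}(xy\xi)^{a}\exp\Bigl(x+y+\xi-\frac{(xy+x\xi+y\xi)^2}{8xy\xi}\Bigr)D_{1-2a}\Bigl(\frac{xy+x\xi+y\xi}{(2xy\xi)^{1/2}}\Bigr).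 \] Then for all $a,\beta\in\mathbb{C}$ and all $x,y>0$ the following integral converges absolutely and \[ \int_0^\infty \xi^\beta q_a(x,y,\xi)\,\mathrm{m}_a(\xi)\,d\xi=(xy)^\beta\,\Psi(\beta,1-2a+2\beta;x+y). \] In particular, for all $a\in\mathbb{C}$ and $x,y>0$, the integral $\int_0^\infty q_a(x,y,\xi)\,\mathrm{m}_a(\xi)\,d\xi$ converges absolutely and equals $1$. -/

import Mathlib

open Filter Asymptotics MeasureTheory Set

noncomputable section

/-- `u` is, on `(0, ∞)`, the solution of Whittaker's differential equation
`u'' + (-1/4 + α/x + (1/4 - ν²)/x²) u = 0` normalised by `u(x) ∼ x^α e^{-x/2}` as `x → ∞`.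
The values of `u` on `(-∞, 0]` play no role. -/
def IsWhittakerW (α ν : ℂ) (u : ℝ → ℂ) : Prop :=
  (∃ u' u'' : ℝ → ℂ, ∀ x : ℝ, 0 < x →
    HasDerivAt u (u' x) x ∧ HasDerivAt u' (u'' x) x ∧
      u'' x + (-(1 / 4) + α / (x : ℂ) + (1 / 4 - ν ^ 2) / (x : ℂ) ^ 2) * u x = 0) ∧
  u ~[atTop] fun x : ℝ => (x : ℂ) ^ α * Complex.exp (-(x : ℂ) / 2)

/-- The Whittaker function `W_{α,ν}(x)`, for `x > 0`: the unique solution of Whittaker's equation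
on `(0, ∞)` that is asymptotic to `x^α e^{-x/2}` at infinity. -/
def whittakerW (α ν : ℂ) (x : ℝ) : ℂ :=
  Classical.epsilon (IsWhittakerW α ν) x

/-- The confluent hypergeometric function of the second kind `Ψ(a,b;x)`, for `x > 0`. -/
def confHypPsi (a b : ℂ) (x : ℝ) : ℂ :=
  Complex.exp ((x : ℂ) / 2) * (x : ℂ) ^ (-b / 2) * whittakerW (b / 2 - a) (b / 2 - 1 / 2) x

/-- The parabolic cylinder function `D_μ(z)`, for `z > 0`. -/
def parabolicCylinderD (μ : ℂ) (z : ℝ) : ℂ :=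
  (2 : ℂ) ^ (μ / 2 + 1 / 4) * (z : ℂ) ^ (-(1 / 2) : ℂ) *
    whittakerW (μ / 2 + 1 / 4) (1 / 4) (z ^ 2 / 2)

/-- The weight `m_a(ξ) = ξ^{-2a-1} e^{-ξ}`. -/
def whittakerWeight (a : ℂ) (ξ : ℝ) : ℂ :=
  (ξ : ℂ) ^ (-2 * a - 1) * Complex.exp (-(ξ : ℂ))

/-- The kernel `q_a(x,y,ξ)` of the product formula for the confluent hypergeometric function. -/
def whittakerKernel (a : ℂ) (x y ξ : ℝ) : ℂ :=
  (2 : ℂ) ^ (-(3 / 2) + a) * (Real.pi : ℂ) ^ (-(1 / 2) : ℂ) * ((x * y * ξ : ℝ) : ℂ) ^ a *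
    Complex.exp ((x + y + ξ - (x * y + x * ξ + y * ξ) ^ 2 / (8 * x * y * ξ) : ℝ) : ℂ) *
    parabolicCylinderD (1 - 2 * a) ((x * y + x * ξ + y * ξ) / Real.sqrt (2 * x * y * ξ))

end

/-! Put α = 1/2 - a, ν = β - a and S = x + y. Everything rests on one function g, the solution of w
g'' + (w + 1/2) g' + (1/2 + α) g = 0 with g(w) ∼ w^α e^{-w}. It is a parabolic cylinder function in
disguise: D_{2α}(z) = 2^α e^{z²/4} g(z²/2). With this, all exponentials in q_a m_a that depend on ξ
cancel, leaving a power of ξ times g((xy + (x+y)ξ)² / (4xyξ))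
(`cpow_mul_whittakerKernel_mul_whittakerWeight`).

The substitution ξ = xy/(x+y) · e^θ turns the argument of g into S cosh²(θ/2), so the integral
depends on x and y only through elementary factors and ∫ e^{νθ} g(S cosh²(θ/2)) dθ. Absolute
convergence is clear in this form: g decays exponentially, so the integrand has Gaussian decay in θ.

As a function of S, that integral times S^{1/2} e^{S/2} / (2√π) is W_{α,ν}(S)
(`isWhittakerW_integral`). The differential equation holds because the relevant combination of
derivatives under the integral is a total θ-derivative (`integral_ode`); the normalisation at
infinity is Laplace's method (`integral_tendsto`). Since W is specified only by its equation and
asymptotics, a uniqueness theorem is needed to identify it with this integral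
(`IsWhittakerW.unique`), and g must be constructed for every complex α
(`exists_isDecayingSolution`).

The total mass 1 is the case β = 0, where the Whittaker function is elementary and Ψ(0, b; ·) = 1.
-/

/-! ### Uniqueness of the normalised Whittaker function. -/

/-- A function which tends to zero together with its second derivative has a derivative tending
to zero. -/
theorem tendsto_deriv_zero_of_tendsto_zero {f f' f'' : ℝ → ℂ}
    (hf : ∀ᶠ x in atTop, HasDerivAt f (f' x) x) (hf' : ∀ᶠ x in atTop, HasDerivAt f' (f'' x) x)
    (h0 : Tendsto f atTop (nhds 0)) (h2 : Tendsto f'' atTop (nhds 0)) :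
    Tendsto f' atTop (nhds 0) := by
  rw [Metric.tendsto_atTop] at h0 h2 ⊢
  intro ε hε
  obtain ⟨A, hA⟩ := eventually_atTop.1 hf
  obtain ⟨B, hB⟩ := eventually_atTop.1 hf'
  obtain ⟨C, hC⟩ := h0 (ε / 4) (by positivity)
  obtain ⟨D, hD⟩ := h2 (ε / 4) (by positivity)
  simp only [dist_zero_right] at hC hD ⊢
  refine ⟨max (max A B) (max C D), fun x hx => ?_⟩
  simp only [ge_iff_le, max_le_iff] at hx
  obtain ⟨⟨h1, h2⟩, h3, h4⟩ := hx
  -- A small f'' makes f' nearly constant on [x, x+1]; hence f' x is close to f (x + 1) - f x, which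
  -- is small.
  have key1 : ∀ t ∈ Icc x (x + 1), ‖f' t - f' x‖ ≤ ε / 4 := by
    intro t ht
    have := (convex_Icc x (x + 1)).norm_image_sub_le_of_norm_hasDerivWithin_le (f := f')
      (f' := f'') (C := ε / 4) (x := x) (y := t)
      (fun s hs => (hB s (h2.trans hs.1)).hasDerivWithinAt)
      (fun s hs => (hD s (h4.trans hs.1)).le) ⟨le_rfl, by linarith⟩ ht
    refine this.trans ?_
    have : ‖t - x‖ ≤ 1 := by
      rw [Real.norm_eq_abs, abs_le]; constructor <;> linarith [ht.1, ht.2]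
    nlinarith
  have key2 : ‖(f (x + 1) - ((x + 1 : ℝ) : ℂ) * f' x) - (f x - (x : ℂ) * f' x)‖ ≤ ε / 4 := by
    have := (convex_Icc x (x + 1)).norm_image_sub_le_of_norm_hasDerivWithin_le
      (f := fun t : ℝ => f t - (t : ℂ) * f' x)
      (f' := fun t => f' t - 1 * f' x) (C := ε / 4) (x := x) (y := x + 1)
      (fun s hs => ((hA s (h1.trans hs.1)).sub
        ((Complex.ofRealCLM.hasDerivAt (x := s)).mul_const (f' x))).hasDerivWithinAt)
      (fun s hs => by simpa using key1 s hs) ⟨le_rfl, by linarith⟩ ⟨by linarith, le_rfl⟩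
    simpa using this
  have e : f' x = f (x + 1) - f x -
      ((f (x + 1) - ((x + 1 : ℝ) : ℂ) * f' x) - (f x - (x : ℂ) * f' x)) := by
    push_cast; ring
  rw [e]
  calc _ ≤ ‖f (x + 1) - f x‖ + _ := norm_sub_le _ _
    _ ≤ (‖f (x + 1)‖ + ‖f x‖) + ε / 4 := add_le_add (norm_sub_le _ _) key2
    _ < ε := by linarith [hC (x + 1) (by linarith), hC x h3]

theorem tendsto_cpow_mul_cexp_neg_mul (s : ℂ) (b : ℝ) (hb : 0 < b) :
    Tendsto (fun x : ℝ => (x : ℂ) ^ s * Complex.exp (-(b : ℂ) * x)) atTop (nhds 0) := by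
  rw [tendsto_zero_iff_norm_tendsto_zero]
  refine (tendsto_rpow_mul_exp_neg_mul_atTop_nhds_zero s.re b hb).congr' ?_
  filter_upwards [eventually_gt_atTop 0] with x hx
  rw [norm_mul, Complex.norm_cpow_eq_rpow_re_of_pos hx, Complex.norm_exp]
  simp

theorem IsWhittakerW.tendsto_zero {α ν : ℂ} {u : ℝ → ℂ} (h : IsWhittakerW α ν u) :
    Tendsto u atTop (nhds 0) := by
  refine h.2.symm.tendsto_nhds ?_
  refine (tendsto_cpow_mul_cexp_neg_mul α (1 / 2) (by norm_num)).congr fun x => ?_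
  congr 2; push_cast; ring

theorem tendsto_whittaker_potential (α ν : ℂ) :
    Tendsto (fun x : ℝ => -(1 / 4) + α / (x : ℂ) + (1 / 4 - ν ^ 2) / (x : ℂ) ^ 2) atTop
      (nhds (-(1 / 4))) := by
  have h : Tendsto (fun x : ℝ => ((x : ℂ))⁻¹) atTop (nhds 0) := by
    have := (Complex.continuous_ofReal.tendsto 0).comp tendsto_inv_atTop_zero
    simpa [Function.comp_def] using this
  have := ((tendsto_const_nhds (x := (-(1 / 4) : ℂ))).add (h.const_mul α)).add
    ((h.pow 2).const_mul (1 / 4 - ν ^ 2))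
  simpa [div_eq_mul_inv] using this

/-- The potential has a finite limit, so the equation forces u'' → 0 along with u. -/
theorem tendsto_deriv_zero_of_whittaker {α ν : ℂ} {u u' u'' : ℝ → ℂ}
    (h : ∀ x : ℝ, 0 < x → HasDerivAt u (u' x) x ∧ HasDerivAt u' (u'' x) x ∧
      u'' x + (-(1 / 4) + α / (x : ℂ) + (1 / 4 - ν ^ 2) / (x : ℂ) ^ 2) * u x = 0)
    (h0 : Tendsto u atTop (nhds 0)) : Tendsto u' atTop (nhds 0) := by
  have hp := eventually_gt_atTop (0 : ℝ)
  refine tendsto_deriv_zero_of_tendsto_zero (f := u) (f'' := u'')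
    (hp.mono fun x hx => (h x hx).1) (hp.mono fun x hx => (h x hx).2.1) h0 ?_
  have := ((tendsto_whittaker_potential α ν).mul h0).neg
  rw [mul_zero, neg_zero] at this
  refine this.congr' (hp.mono fun x hx => ?_)
  linear_combination -(h x hx).2.2

/-- A solution of Whittaker's equation with vanishing initial data on the right vanishes. -/
theorem whittaker_eq_zero_of_initial {α ν : ℂ} {u u' u'' : ℝ → ℂ}
    (h : ∀ x : ℝ, 0 < x → HasDerivAt u (u' x) x ∧ HasDerivAt u' (u'' x) x ∧
      u'' x + (-(1 / 4) + α / (x : ℂ) + (1 / 4 - ν ^ 2) / (x : ℂ) ^ 2) * u x = 0)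
    {b : ℝ} (hb : u b = 0) (hb' : u' b = 0) {x : ℝ} (hx : 0 < x) (hxb : x ≤ b) : u x = 0 := by
  set Q : ℝ → ℂ := fun t => -(1 / 4) + α / (t : ℂ) + (1 / 4 - ν ^ 2) / (t : ℂ) ^ 2 with hQ
  have hQc : ContinuousOn Q (Icc x b) := by
    have hne : ∀ t ∈ Icc x b, (t : ℂ) ≠ 0 := fun t ht => by
      exact_mod_cast (hx.trans_le ht.1).ne'
    refine ((continuousOn_const).add ?_).add ?_
    · exact continuousOn_const.div Complex.continuous_ofReal.continuousOn hne
    · exact continuousOn_const.div (Complex.continuous_ofReal.pow 2).continuousOn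
        fun t ht => pow_ne_zero 2 (hne t ht)
  obtain ⟨K, hK⟩ := isCompact_Icc.exists_bound_of_continuousOn hQc
  -- The equation as a first-order system, Lipschitz on [x, b] because the potential is bounded away
  -- from the singularity at 0. Uniqueness is then applied backwards from b.
  let v : ℝ → ℂ × ℂ → ℂ × ℂ := fun t p => (p.2, -(Q t * p.1))
  have hlip : ∀ t ∈ Ioc x b, LipschitzOnWith (Real.toNNReal (max 1 K)) (v t) univ := by
    intro t ht
    refine LipschitzOnWith.of_dist_le_mul fun p _ q _ => ?_
    rw [Real.coe_toNNReal _ (by positivity), Prod.dist_eq, Prod.dist_eq]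
    have hkt := hK t ⟨ht.1.le, ht.2⟩
    refine max_le ?_ ?_
    · calc dist p.2 q.2 = 1 * dist p.2 q.2 := (one_mul _).symm
        _ ≤ _ := by
          gcongr
          · exact le_max_left _ _
          · exact le_max_right _ _
    · calc dist (-(Q t * p.1)) (-(Q t * q.1)) = ‖Q t‖ * dist p.1 q.1 := by
            rw [dist_neg_neg, dist_eq_norm, dist_eq_norm, ← mul_sub, norm_mul]
        _ ≤ _ := by
          gcongr
          · exact hkt.trans (le_max_right _ _)
          · exact le_max_left _ _
  have hd : ∀ t ∈ Icc x b, HasDerivAt (fun s => (u s, u' s)) (v t (u t, u' t)) t := by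
    intro t ht
    have ht0 := hx.trans_le ht.1
    have := (h t ht0).1.prodMk (h t ht0).2.1
    convert this using 2
    linear_combination -(h t ht0).2.2
  have hd0 : ∀ t : ℝ, HasDerivAt (fun _ => ((0 : ℂ), (0 : ℂ))) (v t (0, 0)) t := by
    intro t
    have e : v t (0, 0) = 0 := by simp [v]
    rw [e]; exact hasDerivAt_const _ _
  have := ODE_solution_unique_of_mem_Icc_left (v := v) (s := fun _ => univ) hlip
    (f := fun s => (u s, u' s)) (g := fun _ => (0, 0))
    (fun t ht => (hd t ht).continuousAt.continuousWithinAt)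
    (fun t ht => (hd t ⟨ht.1.le, ht.2⟩).hasDerivWithinAt) (fun _ _ => mem_univ _)
    continuousOn_const (fun t _ => (hd0 t).hasDerivWithinAt) (fun _ _ => mem_univ _)
    (by simp [hb, hb'])
  exact congrArg Prod.fst (this ⟨le_rfl, hxb⟩)

/-- The normalised decaying solution of Whittaker's equation is unique. -/
theorem IsWhittakerW.unique {α ν : ℂ} {u v : ℝ → ℂ} (hu : IsWhittakerW α ν u)
    (hv : IsWhittakerW α ν v) {x : ℝ} (hx : 0 < x) : u x = v x := by
  have hu0 := hu.tendsto_zero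
  have hv0 := hv.tendsto_zero
  obtain ⟨⟨u', u'', hu⟩, hua⟩ := hu
  obtain ⟨⟨v', v'', hv⟩, hva⟩ := hv
  have hu'0 := tendsto_deriv_zero_of_whittaker hu hu0
  have hv'0 := tendsto_deriv_zero_of_whittaker hv hv0
  -- The Wronskian is constant, and it vanishes because both solutions and their derivatives tend to
  -- zero.
  have hwd : ∀ t ∈ Ioi (0 : ℝ), HasDerivAt (fun t => u t * v' t - u' t * v t) 0 t := by
    intro t ht
    refine (((hu t ht).1.mul (hv t ht).2.1).sub
      ((hu t ht).2.1.mul (hv t ht).1)).congr_deriv ?_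
    linear_combination u t * (hv t ht).2.2 - v t * (hu t ht).2.2
  have hwlim : Tendsto (fun t => u t * v' t - u' t * v t) atTop (nhds 0) := by
    simpa using (hu0.mul hv'0).sub (hu'0.mul hv0)
  have hw : ∀ t ∈ Ioi (0 : ℝ), u t * v' t - u' t * v t = 0 := by
    intro t ht
    refine tendsto_nhds_unique (tendsto_const_nhds.congr' ?_) hwlim
    filter_upwards [eventually_gt_atTop 0] with s hs
    exact isOpen_Ioi.is_const_of_deriv_eq_zero isPreconnected_Ioi
      (fun r hr => (hwd r hr).differentiableAt.differentiableWithinAt)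
      (fun r hr => (hwd r hr).deriv) ht hs
  have hne : ∀ᶠ t : ℝ in atTop, (t : ℂ) ^ α * Complex.exp (-(t : ℂ) / 2) ≠ 0 := by
    filter_upwards [eventually_gt_atTop 0] with t ht
    refine mul_ne_zero ?_ (Complex.exp_ne_zero _)
    rw [Complex.cpow_def_of_ne_zero (by exact_mod_cast ht.ne')]
    exact Complex.exp_ne_zero _
  have hr : Tendsto (fun t => v t / u t) atTop (nhds 1) := by
    have h1 := hva.trans hua.symm
    refine (isEquivalent_iff_tendsto_one ?_).1 h1
    have h2 := (isEquivalent_iff_tendsto_one hne).1 hua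
    filter_upwards [h2.eventually_ne one_ne_zero] with t ht h0
    simp [h0] at ht
  -- Where u vanishes, v / u is 0 by convention, which the limit 1 excludes for large t.
  have hune : ∀ᶠ t in atTop, u t ≠ 0 := by
    filter_upwards [hr.eventually_ne one_ne_zero] with t ht h0
    simp [h0] at ht
  obtain ⟨A, hA⟩ := eventually_atTop.1 hune
  set B := max A (max 0 x) with hB
  have hBA : A ≤ B := le_max_left _ _
  have hB0 : 0 ≤ B := (le_max_left _ _).trans (le_max_right _ _)
  have hBx : x ≤ B := (le_max_right _ _).trans (le_max_right _ _)
  -- The numerator of (v/u)' is the Wronskian, so the ratio is constant beyond B, equal to its limit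
  -- 1.
  have hrd : ∀ t ∈ Ioi B, HasDerivAt (fun t => v t / u t) 0 t := by
    intro t ht
    have ht0 : 0 < t := hB0.trans_lt ht
    refine ((hv t ht0).1.div (hu t ht0).1 (hA t (hBA.trans (le_of_lt ht)))).congr_deriv ?_
    rw [div_eq_zero_iff]
    left
    linear_combination hw t ht0
  have huv : ∀ t ∈ Ioi B, v t = u t := by
    intro t ht
    have : v t / u t = 1 := by
      refine tendsto_nhds_unique (tendsto_const_nhds.congr' ?_) hr
      filter_upwards [eventually_gt_atTop B] with s hs
      exact isOpen_Ioi.is_const_of_deriv_eq_zero isPreconnected_Ioi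
        (fun r hr => (hrd r hr).differentiableAt.differentiableWithinAt)
        (fun r hr => (hrd r hr).deriv) ht hs
    exact (div_eq_one_iff_eq (hA t (hBA.trans (le_of_lt ht)))).1 this
  have hb : B + 1 ∈ Ioi B := by simp
  have hb' : v' (B + 1) = u' (B + 1) := by
    have h0 : 0 < B + 1 := by linarith
    refine (hv _ h0).1.unique ((hu _ h0).1.congr_of_eventuallyEq ?_)
    filter_upwards [isOpen_Ioi.mem_nhds hb] with t ht using huv t ht
  -- The solutions agree near B + 1; uniqueness of the initial value problem carries this down past
  -- possible zeros of u.
  have := whittaker_eq_zero_of_initial (α := α) (ν := ν) (u := fun t => u t - v t)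
    (u' := fun t => u' t - v' t) (u'' := fun t => u'' t - v'' t)
    (fun t ht => ⟨(hu t ht).1.sub (hv t ht).1, (hu t ht).2.1.sub (hv t ht).2.1, by
      linear_combination (hu t ht).2.2 - (hv t ht).2.2⟩)
    (b := B + 1) (by simp [huv _ hb]) (by simp [hb']) hx (by linarith)
  exact sub_eq_zero.1 this

/-- The choice operator returns a genuine solution as soon as one exists, so exhibiting any
normalised solution evaluates W. -/
theorem IsWhittakerW.whittakerW_eq {α ν : ℂ} {u : ℝ → ℂ} (hu : IsWhittakerW α ν u) {x : ℝ}
    (hx : 0 < x) : whittakerW α ν x = u x :=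
  (Classical.epsilon_spec (p := IsWhittakerW α ν) ⟨u, hu⟩).unique hu hx

/-! ### Whittaker's equation after splitting off x^p e^{x/2}. -/

theorem hasDerivAt_ofReal_cpow_mul_cexp_half (p : ℂ) {x : ℝ} (hx : 0 < x) :
    HasDerivAt (fun x : ℝ => (x : ℂ) ^ p * Complex.exp ((x : ℂ) / 2))
      ((x : ℂ) ^ p * Complex.exp ((x : ℂ) / 2) * (p / x + 1 / 2)) x := by
  have hx' : (x : ℂ) ≠ 0 := by exact_mod_cast hx.ne'
  have h1 : HasDerivAt (fun x : ℝ => (x : ℂ) ^ p) (p * (x : ℂ) ^ (p - 1)) x := by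
    have h := (hasDerivAt_id (x : ℂ)).cpow_const (c := p) (Or.inl (by simpa using hx))
    simpa using h.comp_ofReal
  have h2 : HasDerivAt (fun x : ℝ => Complex.exp ((x : ℂ) / 2))
      (Complex.exp ((x : ℂ) / 2) * (1 / 2)) x := by
    have h := ((hasDerivAt_id (x : ℂ)).div_const 2).cexp
    simpa using h.comp_ofReal
  refine (h1.mul h2).congr_deriv ?_
  rw [Complex.cpow_sub _ _ hx', Complex.cpow_one]
  field_simp

/-- Solutions of the form `x^p e^{x/2} Φ(x)`. -/
theorem isWhittakerW_cpow_mul_exp_mul {α ν p : ℂ} {Φ Φ' Φ'' : ℝ → ℂ}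
    (h : ∀ x : ℝ, 0 < x → HasDerivAt Φ (Φ' x) x ∧ HasDerivAt Φ' (Φ'' x) x ∧
      (x : ℂ) ^ 2 * Φ'' x + (2 * p * x + x ^ 2) * Φ' x +
        ((p + α) * x + (p ^ 2 - p + 1 / 4 - ν ^ 2)) * Φ x = 0)
    (ha : Tendsto (fun x : ℝ => Φ x * (x : ℂ) ^ (p - α) * Complex.exp x) atTop (nhds 1)) :
    IsWhittakerW α ν fun x => (x : ℂ) ^ p * Complex.exp ((x : ℂ) / 2) * Φ x := by
  constructor
  · refine ⟨fun x => (x : ℂ) ^ p * Complex.exp ((x : ℂ) / 2) * ((p / x + 1 / 2) * Φ x + Φ' x),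
      fun x => (x : ℂ) ^ p * Complex.exp ((x : ℂ) / 2) * ((p / x + 1 / 2) *
        ((p / x + 1 / 2) * Φ x + Φ' x) + (-p / x ^ 2 * Φ x + (p / x + 1 / 2) * Φ' x + Φ'' x)),
      fun x hx => ?_⟩
    obtain ⟨h1, h2, h3⟩ := h x hx
    have hx' : (x : ℂ) ≠ 0 := by exact_mod_cast hx.ne'
    have h4 := hasDerivAt_ofReal_cpow_mul_cexp_half p hx
    have h5 : HasDerivAt (fun x : ℝ => p / (x : ℂ) + 1 / 2) (-p / x ^ 2) x := by
      have h := ((hasDerivAt_inv hx').const_mul p).add_const (1 / 2)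
      exact h.comp_ofReal.congr_deriv (by ring)
    refine ⟨?_, ?_, ?_⟩
    · refine (h4.mul h1).congr_deriv ?_
      ring
    · refine (h4.mul ((h5.mul h1).add h2)).congr_deriv ?_
      simp only [Pi.add_apply, Pi.mul_apply]
      ring
    · have : Φ'' x = -((2 * p * x + x ^ 2) * Φ' x +
        ((p + α) * x + (p ^ 2 - p + 1 / 4 - ν ^ 2)) * Φ x) / x ^ 2 := by
        rw [eq_div_iff (pow_ne_zero 2 hx')]
        linear_combination h3
      beta_reduce
      rw [this]
      field_simp
      ring
  · refine (isEquivalent_iff_tendsto_one ?_).2 (ha.congr' ?_)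
    · filter_upwards [eventually_gt_atTop 0] with t ht
      refine mul_ne_zero ?_ (Complex.exp_ne_zero _)
      rw [Complex.cpow_def_of_ne_zero (by exact_mod_cast ht.ne')]
      exact Complex.exp_ne_zero _
    · filter_upwards [eventually_gt_atTop 0] with x hx
      have hx' : (x : ℂ) ≠ 0 := by exact_mod_cast hx.ne'
      have e : Complex.exp (x : ℂ) = Complex.exp ((x : ℂ) / 2) * Complex.exp ((x : ℂ) / 2) := by
        rw [← Complex.exp_add]; congr 1; ring
      have e2 : Complex.exp (-(x : ℂ) / 2) = (Complex.exp ((x : ℂ) / 2))⁻¹ := by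
        rw [← Complex.exp_neg]; congr 1; ring
      have hxa : (x : ℂ) ^ α ≠ 0 := by simp [Complex.cpow_eq_zero_iff, hx']
      have := Complex.exp_ne_zero ((x : ℂ) / 2)
      simp only [Pi.div_apply]
      rw [Complex.cpow_sub _ _ hx', e, e2]
      field_simp

/-! ### Construction of the decaying solution g. -/

/-- Differentiation of Laplace-type integrals under the integral sign. -/
theorem integrable_and_hasDerivAt_integral_cexp_neg_mul {μ : Measure ℝ} {p : ℝ → ℝ} {f : ℝ → ℂ}
    (hp : ∀ᵐ t ∂μ, 0 ≤ p t) (hpc : Continuous p)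
    (hf : ∀ ε : ℝ, 0 < ε → Integrable (fun t => Complex.exp (-(ε * p t)) * f t) μ) :
    (∀ ε : ℝ, 0 < ε → Integrable (fun t => Complex.exp (-(ε * p t)) * (p t * f t)) μ) ∧
    ∀ w : ℝ, 0 < w → HasDerivAt (fun w : ℝ => ∫ t, Complex.exp (-(w * p t)) * f t ∂μ)
      (-∫ t, Complex.exp (-(w * p t)) * (p t * f t) ∂μ) w := by
  have hexp : ∀ x t : ℝ, ‖Complex.exp (-((x : ℂ) * p t))‖ = Real.exp (-(x * p t)) := by
    intro x t
    rw [Complex.norm_exp]; simp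
  have hmeas : ∀ x : ℝ, 0 < x →
      AEStronglyMeasurable (fun t => Complex.exp (-(x * p t)) * (p t * f t)) μ := by
    intro x hx
    have := ((Complex.continuous_ofReal.comp hpc).aestronglyMeasurable (μ := μ)).mul
      (hf x hx).aestronglyMeasurable
    refine this.congr (Eventually.of_forall fun t => ?_)
    simp only [Pi.mul_apply, Function.comp_apply]; ring
  have hint : ∀ ε : ℝ, 0 < ε →
      Integrable (fun t => Complex.exp (-(ε * p t)) * (p t * f t)) μ := by
    intro ε hε
    refine (((hf (ε / 2) (by positivity)).norm).const_mul (2 / ε)).mono' (hmeas ε hε) ?_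
    filter_upwards [hp] with t ht
    rw [norm_mul, norm_mul, norm_mul, hexp, hexp, Complex.norm_real, Real.norm_of_nonneg ht]
    -- Half of the exponential absorbs the factor p, leaving the integrable function at ε / 2.
    have h1 : p t * Real.exp (-(ε * p t)) ≤ 2 / ε * Real.exp (-(ε / 2 * p t)) := by
      have h2 : ε / 2 * p t ≤ Real.exp (ε / 2 * p t) :=
        (by linarith [Real.add_one_le_exp (ε / 2 * p t)])
      have h3 : Real.exp (-(ε * p t)) =
          Real.exp (-(ε / 2 * p t)) * Real.exp (-(ε / 2 * p t)) := by
        rw [← Real.exp_add]; congr 1; ring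
      have h4 : Real.exp (ε / 2 * p t) * Real.exp (-(ε / 2 * p t)) = 1 := by
        rw [← Real.exp_add]; simp
      have h5 : p t * Real.exp (-(ε / 2 * p t)) ≤ 2 / ε := by
        rw [le_div_iff₀ hε]
        have := mul_le_mul_of_nonneg_right h2 (Real.exp_pos (-(ε / 2 * p t))).le
        rw [h4] at this
        linarith
      calc _ = p t * Real.exp (-(ε / 2 * p t)) * Real.exp (-(ε / 2 * p t)) := by
            rw [h3]; ring
        _ ≤ _ := by gcongr
    calc _ = p t * Real.exp (-(ε * p t)) * ‖f t‖ := by ring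
      _ ≤ 2 / ε * Real.exp (-(ε / 2 * p t)) * ‖f t‖ := by gcongr
      _ = _ := by ring
  refine ⟨hint, fun w hw => ?_⟩
  -- For parameters above w / 2 the derivative is dominated by its size at w / 2, since p ≥ 0 almost
  -- everywhere.
  have hs : Ioi (w / 2) ∈ nhds w := isOpen_Ioi.mem_nhds (by simpa using hw)
  have := hasDerivAt_integral_of_dominated_loc_of_deriv_le (μ := μ) (𝕜 := ℝ) (x₀ := w)
    (F := fun (x : ℝ) t => Complex.exp (-(x * p t)) * f t)
    (F' := fun (x : ℝ) t => -(Complex.exp (-(x * p t)) * (p t * f t)))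
    (bound := fun t => ‖Complex.exp (-((w / 2 : ℝ) * p t)) * (p t * f t)‖)
    hs ?_ (hf w hw) (hmeas w hw).neg ?_ (hint _ (by positivity)).norm ?_
  · have h := this.2
    rwa [integral_neg] at h
  · filter_upwards [eventually_gt_nhds hw] with x hx using (hf x hx).aestronglyMeasurable
  · filter_upwards [hp] with t ht x hx
    rw [norm_neg, norm_mul, hexp, norm_mul (Complex.exp (-(((w / 2 : ℝ) : ℂ) * p t))), hexp]
    have : w / 2 < x := hx
    gcongr
  · filter_upwards with t x _
    have h := ((((hasDerivAt_id (x : ℂ)).mul_const (p t : ℂ)).neg).cexp).mul_const (f t)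
    refine h.comp_ofReal.congr_deriv ?_
    simp only [id, Pi.neg_apply]; ring

/-- `g` is a solution, with derivative `g'`, of `w g'' + (w + 1/2) g' + (1/2 + α) g = 0` on
`(0, ∞)` with `g(w) ∼ w^α e^{-w}` and `g'(w) ∼ -w^α e^{-w}` as `w → ∞`. -/
structure IsDecayingSolution (α : ℂ) (g g' : ℝ → ℂ) : Prop where
  hasDerivAt : ∀ w : ℝ, 0 < w → HasDerivAt g (g' w) w
  hasDerivAt' : ∀ w : ℝ, 0 < w →
    HasDerivAt g' (-((w + 1 / 2) * g' w + (1 / 2 + α) * g w) / w) w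
  tendsto : Tendsto (fun w : ℝ => g w * (w : ℂ) ^ (-α) * Complex.exp w) atTop (nhds 1)
  tendsto' : Tendsto (fun w : ℝ => g' w * (w : ℂ) ^ (-α) * Complex.exp w) atTop (nhds (-1))

theorem norm_one_add_ofReal_cpow (q : ℂ) {t : ℝ} (ht : 0 ≤ t) :
    ‖(1 + (t : ℂ)) ^ q‖ = (1 + t) ^ q.re := by
  have : (1 + (t : ℂ)) = ((1 + t : ℝ) : ℂ) := by push_cast; rfl
  rw [this, Complex.norm_cpow_eq_rpow_re_of_pos (by linarith)]

theorem norm_one_add_ofReal_cpow_le_one {q : ℂ} (hq : q.re ≤ 0) {t : ℝ} (ht : 0 ≤ t) :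
    ‖(1 + (t : ℂ)) ^ q‖ ≤ 1 := by
  rw [norm_one_add_ofReal_cpow q ht]
  exact Real.rpow_le_one_of_one_le_of_nonpos (by linarith) hq

theorem continuousOn_one_add_ofReal_cpow (q : ℂ) :
    ContinuousOn (fun t : ℝ => (1 + (t : ℂ)) ^ q) (Ici 0) := by
  refine ContinuousOn.cpow_const (by fun_prop) fun t ht => ?_
  left
  have : (0 : ℝ) ≤ t := ht
  simp only [Complex.add_re, Complex.one_re, Complex.ofReal_re]
  linarith

theorem continuousOn_ofReal_cpow (q : ℂ) : ContinuousOn (fun t : ℝ => (t : ℂ) ^ q) (Ioi 0) :=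
  fun t ht => (Complex.continuousAt_ofReal_cpow_const t q
    (Or.inr (ne_of_gt ht))).continuousWithinAt

/-- The Laplace transform behind the confluent hypergeometric function. -/
theorem integrableOn_cexp_neg_mul_cpow {α q : ℂ} (hα : α.re < 0) (hq : q.re ≤ 0) {ε : ℝ}
    (hε : 0 < ε) : IntegrableOn (fun t : ℝ => Complex.exp (-(ε * ((1 + t : ℝ) : ℂ))) *
      ((t : ℂ) ^ (-α - 1) * (1 + (t : ℂ)) ^ q)) (Ioi 0) := by
  have h := integrableOn_rpow_mul_exp_neg_mul_rpow (p := 1) (s := -α.re - 1) (b := ε)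
    (by linarith) one_pos hε
  refine Integrable.mono' h ?_ ?_
  · refine ContinuousOn.aestronglyMeasurable ?_ measurableSet_Ioi
    refine ContinuousOn.mul (by fun_prop) ((continuousOn_ofReal_cpow _).mul
      ((continuousOn_one_add_ofReal_cpow q).mono Ioi_subset_Ici_self))
  · refine (ae_restrict_iff' measurableSet_Ioi).2 (Eventually.of_forall fun t ht => ?_)
    have ht : 0 < t := ht
    rw [norm_mul, norm_mul, Complex.norm_exp, Complex.norm_cpow_eq_rpow_re_of_pos ht]
    have h1 := norm_one_add_ofReal_cpow_le_one hq ht.le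
    have h2 : (-((ε : ℂ) * ((1 + t : ℝ) : ℂ))).re = -(ε * (1 + t)) := by
      rw [← Complex.ofReal_mul, ← Complex.ofReal_neg, Complex.ofReal_re]
    rw [h2, Real.rpow_one]
    simp only [Complex.sub_re, Complex.neg_re, Complex.one_re]
    calc _ ≤ Real.exp (-ε * t) * (t ^ (-α.re - 1) * 1) := by
          gcongr
          linarith
      _ = _ := by ring

/-- Rescaling s = wt turns the left side into the Gamma integral with an extra factor (1 + s/w)^q.
This factor tends to 1 and is bounded by 1 because Re q ≤ 0. -/
theorem tendsto_integral_cexp_neg_mul_cpow {α q : ℂ} (hα : α.re < 0) (hq : q.re ≤ 0) :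
    Tendsto (fun w : ℝ => (∫ t in Ioi (0 : ℝ), Complex.exp (-(w * ((1 + t : ℝ) : ℂ))) *
      ((t : ℂ) ^ (-α - 1) * (1 + (t : ℂ)) ^ q)) * (w : ℂ) ^ (-α) * Complex.exp w) atTop
      (nhds (Complex.Gamma (-α))) := by
  have hG : Complex.Gamma (-α) =
      ∫ s in Ioi (0 : ℝ), ((-s).exp : ℂ) * (s : ℂ) ^ (-α - 1) := by
    rw [Complex.Gamma_eq_integral (by simpa using hα), Complex.GammaIntegral]
  rw [hG]
  have key : Tendsto (fun w : ℝ => ∫ s in Ioi (0 : ℝ), ((-s).exp : ℂ) * (s : ℂ) ^ (-α - 1) *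
      (1 + ((s / w : ℝ) : ℂ)) ^ q) atTop
      (nhds (∫ s in Ioi (0 : ℝ), ((-s).exp : ℂ) * (s : ℂ) ^ (-α - 1))) := by
    refine tendsto_integral_filter_of_dominated_convergence
      (fun s : ℝ => ‖((-s).exp : ℂ) * (s : ℂ) ^ (-α - 1)‖) ?_ ?_ ?_ ?_
    · filter_upwards [eventually_gt_atTop 0] with w hw
      refine ContinuousOn.aestronglyMeasurable ?_ measurableSet_Ioi
      refine ContinuousOn.mul (ContinuousOn.mul (by fun_prop) (continuousOn_ofReal_cpow _)) ?_
      refine (continuousOn_one_add_ofReal_cpow q).comp (f := fun s => s / w) (by fun_prop) ?_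
      exact fun s hs => div_nonneg (le_of_lt hs) hw.le
    · filter_upwards [eventually_gt_atTop 0] with w hw
      refine (ae_restrict_iff' measurableSet_Ioi).2 (Eventually.of_forall fun s hs => ?_)
      have hs : 0 < s := hs
      rw [norm_mul]
      exact mul_le_of_le_one_right (norm_nonneg _)
        (norm_one_add_ofReal_cpow_le_one hq (by positivity))
    · have := Complex.GammaIntegral_convergent (s := -α) (by simpa using hα)
      exact this.norm
    · refine Eventually.of_forall fun s => ?_
      have h1 : Tendsto (fun w : ℝ => (1 + ((s / w : ℝ) : ℂ)) ^ q) atTop 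
          (nhds ((1 + ((0 : ℝ) : ℂ)) ^ q)) := by
        have h0 : Tendsto (fun w : ℝ => s / w) atTop (nhds 0) :=
          tendsto_const_nhds.div_atTop tendsto_id
        have h2 : ContinuousAt (fun z : ℝ => (1 + (z : ℂ)) ^ q) 0 := by
          exact ContinuousAt.cpow (by fun_prop) continuousAt_const (by simp)
        exact h2.tendsto.comp h0
      have h3 := h1.const_mul (((-s).exp : ℂ) * (s : ℂ) ^ (-α - 1))
      simpa using h3
  refine key.congr' ?_
  filter_upwards [eventually_gt_atTop 0] with w hw
  have hw' : (w : ℂ) ≠ 0 := by exact_mod_cast hw.ne'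
  have h := integral_comp_mul_left_Ioi (fun s : ℝ => ((-s).exp : ℂ) * (s : ℂ) ^ (-α - 1) *
      (1 + ((s / w : ℝ) : ℂ)) ^ q) 0 hw
  rw [mul_zero, eq_comm, inv_smul_eq_iff₀ hw.ne'] at h
  rw [h, Complex.real_smul, mul_assoc, mul_comm _ ((w : ℂ) ^ (-α) * Complex.exp w),
    ← integral_const_mul, ← integral_const_mul]
  refine setIntegral_congr_fun measurableSet_Ioi fun t ht => ?_
  have ht : 0 < t := ht
  have e1 : w * t / w = t := by field_simp
  have e2 : ((w * t : ℝ) : ℂ) ^ (-α - 1) = (w : ℂ) ^ (-α) / w * (t : ℂ) ^ (-α - 1) := by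
    rw [Complex.ofReal_mul, Complex.mul_cpow_ofReal_nonneg hw.le ht.le, Complex.cpow_sub _ _ hw',
      Complex.cpow_one]
  have e3 : ((Real.exp (-(w * t)) : ℝ) : ℂ) =
      Complex.exp w * Complex.exp (-(w * ((1 + t : ℝ) : ℂ))) := by
    rw [← Complex.exp_add]; push_cast; congr 1; ring
  rw [e1, e2, e3]
  field_simp

/-- The solution is the Laplace integral of t^{-α-1} (1+t)^{α-1/2} against e^{-w(1+t)}, divided by
Γ(-α). The bound on Re α gives convergence at t = 0 and keeps the exponents α ± 1/2 of 1 + t in the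
left half-plane, as needed for the asymptotics of g and g'. -/
theorem exists_isDecayingSolution_of_re_lt {α : ℂ} (hα : α.re < -1) :
    ∃ g g' : ℝ → ℂ, IsDecayingSolution α g g' := by
  have hα0 : α.re < 0 := by linarith
  have hαne : α ≠ 0 := fun h => by simp [h] at hα0
  set f : ℝ → ℂ := fun t => (t : ℂ) ^ (-α - 1) * (1 + (t : ℂ)) ^ (α - 1 / 2) with hf
  set p : ℝ → ℝ := fun t => 1 + t with hp
  have hpc : Continuous p := by fun_prop
  have hp0 : ∀ᵐ t ∂(volume.restrict (Ioi (0 : ℝ))), 0 ≤ p t :=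
    (ae_restrict_iff' measurableSet_Ioi).2 (Eventually.of_forall fun t ht => by
      have : (0 : ℝ) < t := ht
      simp only [hp]; linarith)
  have hi0 : ∀ ε : ℝ, 0 < ε → IntegrableOn (fun t => Complex.exp (-(ε * p t)) * f t) (Ioi 0) :=
    fun ε hε => integrableOn_cexp_neg_mul_cpow hα0 (by simp; linarith) hε
  obtain ⟨hi1, hd0⟩ := integrable_and_hasDerivAt_integral_cexp_neg_mul hp0 hpc hi0
  obtain ⟨hi2, hd1⟩ := integrable_and_hasDerivAt_integral_cexp_neg_mul hp0 hpc hi1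
  set A0 : ℝ → ℂ := fun w => ∫ t in Ioi (0 : ℝ), Complex.exp (-(w * p t)) * f t with hA0
  set A1 : ℝ → ℂ := fun w => ∫ t in Ioi (0 : ℝ), Complex.exp (-(w * p t)) * (p t * f t) with hA1
  set A2 : ℝ → ℂ := fun w => ∫ t in Ioi (0 : ℝ),
    Complex.exp (-(w * p t)) * (p t * (p t * f t)) with hA2
  have hode : ∀ w : ℝ, 0 < w → w * A2 w - (w + 1 / 2) * A1 w + (1 / 2 + α) * A0 w = 0 := by
    intro w hw
    have hI : IntegrableOn (fun t => w * (Complex.exp (-(w * p t)) * (p t * (p t * f t))) -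
        (w + 1 / 2) * (Complex.exp (-(w * p t)) * (p t * f t)) +
        (1 / 2 + α) * (Complex.exp (-(w * p t)) * f t)) (Ioi 0) :=
      (((hi2 w hw).const_mul _).sub ((hi1 w hw).const_mul _)).add ((hi0 w hw).const_mul _)
    have e : w * A2 w - (w + 1 / 2) * A1 w + (1 / 2 + α) * A0 w =
        ∫ t in Ioi (0 : ℝ), (w * (Complex.exp (-(w * p t)) * (p t * (p t * f t))) -
        (w + 1 / 2) * (Complex.exp (-(w * p t)) * (p t * f t)) +
        (1 / 2 + α) * (Complex.exp (-(w * p t)) * f t)) := by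
      simp only [hA0, hA1, hA2]
      rw [← integral_const_mul, ← integral_const_mul, ← integral_const_mul]
      rw [← integral_sub, ← integral_add]
      · exact ((hi2 w hw).const_mul _).sub ((hi1 w hw).const_mul _)
      · exact (hi0 w hw).const_mul _
      · exact (hi2 w hw).const_mul _
      · exact (hi1 w hw).const_mul _
    rw [e]
    -- The ODE combination of integrands is the t-derivative of B. Both boundary values vanish: at 0
    -- because Re(-α) > 0, at infinity because of the exponential.
    set B : ℝ → ℂ := fun t =>
      -(Complex.exp (-(w * p t)) * ((t : ℂ) ^ (-α) * (1 + (t : ℂ)) ^ (α + 1 / 2))) with hB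
    have hB0 : B 0 = 0 := by simp [hB, hαne]
    have hcont : ContinuousWithinAt B (Ici 0) 0 := by
      refine ContinuousWithinAt.neg (ContinuousWithinAt.mul (by fun_prop)
        (ContinuousWithinAt.mul ?_ ?_))
      · exact (Complex.continuousAt_ofReal_cpow_const 0 (-α)
          (Or.inl (by simpa using hα0))).continuousWithinAt
      · exact continuousOn_one_add_ofReal_cpow _ 0 (by simp)
    have hlim : Tendsto B atTop (nhds 0) := by
      have h := tendsto_rpow_mul_exp_neg_mul_atTop_nhds_zero (-α.re) w hw
      refine squeeze_zero_norm' ?_ h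
      filter_upwards [eventually_gt_atTop 0] with t ht
      have h1 := norm_one_add_ofReal_cpow_le_one (q := α + 1 / 2) (by simp; linarith) ht.le
      rw [norm_neg, norm_mul, norm_mul, Complex.norm_exp, Complex.norm_cpow_eq_rpow_re_of_pos ht]
      have h2 : (-((w : ℂ) * (p t : ℂ))).re = -(w * (1 + t)) := by
        rw [← Complex.ofReal_mul, ← Complex.ofReal_neg, Complex.ofReal_re]
      rw [h2]
      simp only [Complex.neg_re]
      calc _ ≤ Real.exp (-w * t) * (t ^ (-α.re) * 1) := by
            gcongr
            linarith
        _ = _ := by ring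
    have := integral_Ioi_of_hasDerivAt_of_tendsto hcont (fun t ht => ?_) hI hlim
    · rw [this, hB0, sub_zero]
    have ht : 0 < t := ht
    have ht' : (t : ℂ) ≠ 0 := by exact_mod_cast ht.ne'
    have ht1 : (1 + (t : ℂ)) ≠ 0 := by
      have : ((1 + t : ℝ) : ℂ) ≠ 0 := by exact_mod_cast (by linarith : (1 + t : ℝ) ≠ 0)
      simpa using this
    have d1 : HasDerivAt (fun z : ℂ => z ^ (-α)) (-α * (t : ℂ) ^ (-α - 1)) t := by
      simpa using (hasDerivAt_id (t : ℂ)).cpow_const (c := -α) (Or.inl (by simpa using ht))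
    have d2 : HasDerivAt (fun z : ℂ => (1 + z) ^ (α + 1 / 2))
        ((α + 1 / 2) * (1 + (t : ℂ)) ^ (α - 1 / 2)) t := by
      have h := ((hasDerivAt_id (t : ℂ)).const_add 1).cpow_const (c := α + 1 / 2)
        (Or.inl (by simp; linarith))
      refine h.congr_deriv ?_
      simp only [id, mul_one]
      congr 2; ring
    have d3 : HasDerivAt (fun z : ℂ => Complex.exp (-(w * (1 + z))))
        (-w * Complex.exp (-(w * (1 + (t : ℂ))))) t := by
      have h := ((((hasDerivAt_id (t : ℂ)).const_add 1).const_mul (w : ℂ)).neg).cexp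
      refine h.congr_deriv ?_
      simp only [id, Pi.neg_apply]; ring
    have d := ((d3.mul (d1.mul d2)).neg).comp_ofReal
    have hBe : B = fun t : ℝ => (-((fun z : ℂ => Complex.exp (-(w * (1 + z)))) *
        ((fun z : ℂ => z ^ (-α)) * fun z : ℂ => (1 + z) ^ (α + 1 / 2)))) (t : ℂ) := by
      funext t
      simp [hB, hp]
    rw [hBe]
    refine d.congr_deriv ?_
    have e1 : (t : ℂ) ^ (-α) = (t : ℂ) ^ (-α - 1) * t := by
      rw [Complex.cpow_sub _ _ ht', Complex.cpow_one]; field_simp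
    have e2 : (1 + (t : ℂ)) ^ (α + 1 / 2) = (1 + (t : ℂ)) ^ (α - 1 / 2) * (1 + t) := by
      rw [show α + 1 / 2 = (α - 1 / 2) + 1 by ring, Complex.cpow_add _ _ ht1, Complex.cpow_one]
    simp only [Pi.mul_apply, hf, hp, e1, e2]
    push_cast
    ring
  have hΓ : Complex.Gamma (-α) ≠ 0 := Complex.Gamma_ne_zero_of_re_pos (by simpa using hα0)
  have hl0 := tendsto_integral_cexp_neg_mul_cpow hα0 (q := α - 1 / 2) (by simp; linarith)
  have hl1 := tendsto_integral_cexp_neg_mul_cpow hα0 (q := α + 1 / 2) (by simp; linarith)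
  have hA1e : ∀ w : ℝ, A1 w = ∫ t in Ioi (0 : ℝ), Complex.exp (-(w * ((1 + t : ℝ) : ℂ))) *
      ((t : ℂ) ^ (-α - 1) * (1 + (t : ℂ)) ^ (α + 1 / 2)) := by
    intro w
    refine setIntegral_congr_fun measurableSet_Ioi fun t ht => ?_
    have ht : 0 < t := ht
    have ht1 : (1 + (t : ℂ)) ≠ 0 := by
      have : ((1 + t : ℝ) : ℂ) ≠ 0 := by exact_mod_cast (by linarith : (1 + t : ℝ) ≠ 0)
      simpa using this
    have e2 : (1 + (t : ℂ)) ^ (α + 1 / 2) = (1 + (t : ℂ)) ^ (α - 1 / 2) * (1 + t) := by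
      rw [show α + 1 / 2 = (α - 1 / 2) + 1 by ring, Complex.cpow_add _ _ ht1, Complex.cpow_one]
    simp only [hf, hp, e2]
    push_cast
    ring
  refine ⟨fun w => (Complex.Gamma (-α))⁻¹ * A0 w, fun w => (Complex.Gamma (-α))⁻¹ * -A1 w,
    fun w hw => (hd0 w hw).const_mul _, fun w hw => ?_, ?_, ?_⟩
  · refine ((hd1 w hw).neg.const_mul _).congr_deriv ?_
    have hw' : (w : ℂ) ≠ 0 := by exact_mod_cast hw.ne'
    rw [eq_div_iff hw']
    change (Complex.Gamma (-α))⁻¹ * - -A2 w * w = _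
    linear_combination (Complex.Gamma (-α))⁻¹ * hode w hw
  · have := hl0.const_mul (Complex.Gamma (-α))⁻¹
    rw [inv_mul_cancel₀ hΓ] at this
    refine this.congr fun w => ?_
    simp only [hA0, hf, hp]; ring
  · have := (hl1.const_mul (Complex.Gamma (-α))⁻¹).neg
    rw [inv_mul_cancel₀ hΓ] at this
    refine this.congr fun w => ?_
    rw [hA1e]; ring

/-- A contiguous relation raising α by 1. The term -w g' supplies the leading behaviour w^{α+1}
e^{-w}; the other term is smaller by a factor of order 1/w. -/
theorem IsDecayingSolution.add_one {α : ℂ} {g g' : ℝ → ℂ} (h : IsDecayingSolution α g g') :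
    IsDecayingSolution (α + 1) (fun w => -(1 / 2 + α) * g w - w * g' w)
      (fun w => (w - 1 - α) * g' w + (1 / 2 + α) * g w) := by
  have hid : ∀ w : ℝ, HasDerivAt (fun w : ℝ => (w : ℂ)) 1 w := fun w =>
    Complex.ofRealCLM.hasDerivAt (x := w)
  have hinv : Tendsto (fun x : ℝ => ((x : ℂ))⁻¹) atTop (nhds 0) := by
    have := (Complex.continuous_ofReal.tendsto 0).comp tendsto_inv_atTop_zero
    simpa [Function.comp_def] using this
  have hpow : ∀ᶠ w : ℝ in atTop, (w : ℂ) ≠ 0 ∧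
      (w : ℂ) ^ (-(α + 1)) = (w : ℂ) ^ (-α) * (w : ℂ)⁻¹ := by
    filter_upwards [eventually_gt_atTop 0] with w hw
    have hw' : (w : ℂ) ≠ 0 := by exact_mod_cast hw.ne'
    rw [show -(α + 1) = -α - 1 by ring, Complex.cpow_sub _ _ hw', Complex.cpow_one]
    exact ⟨hw', by field_simp⟩
  refine ⟨fun w hw => ?_, fun w hw => ?_, ?_, ?_⟩
  · have hw' : (w : ℂ) ≠ 0 := by exact_mod_cast hw.ne'
    refine (((h.hasDerivAt w hw).const_mul _).sub
      ((hid w).mul (h.hasDerivAt' w hw))).congr_deriv ?_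
    field_simp
    ring
  · have hw' : (w : ℂ) ≠ 0 := by exact_mod_cast hw.ne'
    refine (((((hid w).sub_const 1).sub_const α).mul (h.hasDerivAt' w hw)).add
      ((h.hasDerivAt w hw).const_mul _)).congr_deriv ?_
    field_simp
    ring
  · have := ((hinv.mul h.tendsto).const_mul (-(1 / 2 + α))).sub h.tendsto'
    rw [zero_mul, mul_zero, zero_sub, neg_neg] at this
    refine this.congr' ?_
    filter_upwards [hpow] with w hw
    rw [hw.2]
    have := hw.1
    field_simp
  · have := ((h.tendsto').sub ((hinv.mul h.tendsto').const_mul (1 + α))).add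
      ((hinv.mul h.tendsto).const_mul (1 / 2 + α))
    rw [zero_mul, zero_mul, mul_zero, mul_zero, sub_zero, add_zero] at this
    refine this.congr' ?_
    filter_upwards [hpow] with w hw
    rw [hw.2]
    have := hw.1
    field_simp
    ring

/-- The Laplace integral covers Re α < -1, and the contiguous relation moves right in unit steps
from there. -/
theorem exists_isDecayingSolution (α : ℂ) : ∃ g g' : ℝ → ℂ, IsDecayingSolution α g g' := by
  obtain ⟨n, hn⟩ := exists_nat_gt (α.re + 1)
  have key : ∀ n : ℕ, ∀ α : ℂ, α.re + 1 < n → ∃ g g' : ℝ → ℂ, IsDecayingSolution α g g' := by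
    intro n
    induction n with
    | zero => exact fun α h => exists_isDecayingSolution_of_re_lt (by norm_num at h; linarith)
    | succ n ih =>
      intro α h
      obtain ⟨g, g', hg⟩ := ih (α - 1) (by simp at h ⊢; linarith)
      have := hg.add_one
      rw [sub_add_cancel] at this
      exact ⟨_, _, this⟩
  exact key n α hn

/-! ### Gaussian bounds and differentiation for integrals of h(S cosh²(θ/2)). -/

theorem sq_cosh_half_eq (θ : ℝ) : Real.cosh (θ / 2) ^ 2 = 1 + Real.sinh (θ / 2) ^ 2 := by
  rw [Real.cosh_sq]; ring

theorem one_add_sq_le_sq_cosh_half (θ : ℝ) : 1 + θ ^ 2 / 4 ≤ Real.cosh (θ / 2) ^ 2 := by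
  have h : (θ / 2) ^ 2 ≤ Real.sinh (θ / 2) ^ 2 := by
    rw [sq_le_sq, Real.abs_sinh]
    exact Real.self_le_sinh_iff.2 (abs_nonneg _)
  rw [sq_cosh_half_eq]
  nlinarith

theorem one_le_sq_cosh_half (θ : ℝ) : 1 ≤ Real.cosh (θ / 2) ^ 2 :=
  one_le_pow₀ (Real.one_le_cosh _)

theorem cosh_le_exp_abs (x : ℝ) : Real.cosh x ≤ Real.exp |x| := by
  rw [Real.cosh_eq]
  have h1 : Real.exp x ≤ Real.exp |x| := Real.exp_le_exp.2 (le_abs_self x)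
  have h2 : Real.exp (-x) ≤ Real.exp |x| := Real.exp_le_exp.2 (neg_le_abs x)
  linarith

theorem sq_cosh_half_le (θ : ℝ) : Real.cosh (θ / 2) ^ 2 ≤ Real.exp |θ| := by
  have h : Real.exp |θ| = Real.exp |θ / 2| ^ 2 := by
    rw [← Real.exp_nat_mul, abs_div]; norm_num; ring_nf
  rw [h]
  gcongr
  exact cosh_le_exp_abs _

theorem abs_sinh_mul_cosh_half_le (θ : ℝ) :
    |Real.sinh (θ / 2) * Real.cosh (θ / 2)| ≤ Real.exp |θ| := by
  refine le_trans ?_ (sq_cosh_half_le θ)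
  rw [abs_mul, abs_of_pos (Real.cosh_pos _), sq]
  refine mul_le_mul_of_nonneg_right ?_ (Real.cosh_pos _).le
  refine abs_le_of_sq_le_sq ?_ (Real.cosh_pos _).le
  rw [Real.cosh_sq]; linarith

theorem integrable_exp_mul_abs_sub_sq (A : ℝ) {b : ℝ} (hb : 0 < b) :
    Integrable fun θ : ℝ => Real.exp (A * |θ| - b * θ ^ 2) := by
  have h : ∀ A : ℝ, Integrable fun θ : ℝ => Real.exp (A * θ - b * θ ^ 2) := by
    intro A
    refine (integrable_cexp_quadratic (b := (b : ℂ)) (by simpa using hb) A 0).norm.congr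
      (Eventually.of_forall fun θ => ?_)
    have : (-(b : ℂ) * (θ : ℂ) ^ 2 + (A : ℂ) * θ + 0) = ((A * θ - b * θ ^ 2 : ℝ) : ℂ) := by
      push_cast; ring
    beta_reduce
    rw [this, Complex.norm_exp, Complex.ofReal_re]
  refine ((h A).add (h (-A))).mono' (by fun_prop) (Eventually.of_forall fun θ => ?_)
  rw [Real.norm_of_nonneg (Real.exp_pos _).le, Pi.add_apply]
  rcases abs_choice θ with e | e <;> rw [e]
  · linarith [Real.exp_pos (-A * θ - b * θ ^ 2)]
  · rw [mul_neg, ← neg_mul]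
    linarith [Real.exp_pos (A * θ - b * θ ^ 2)]

/-- Continuous functions on `(0, ∞)` which are `O(e^{-w/2})` away from zero. -/
def IsExpDecaying (h : ℝ → ℂ) : Prop :=
  ContinuousOn h (Ioi 0) ∧ ∀ w₀ : ℝ, 0 < w₀ → ∃ C : ℝ, 0 ≤ C ∧ ∀ w : ℝ, w₀ ≤ w →
    ‖h w‖ ≤ C * Real.exp (-(w / 2))

/-- Half of e^{-w} absorbs the power w^α at infinity; compactness handles the remaining interval
[w₀, A]. -/
theorem isExpDecaying_of_tendsto {h : ℝ → ℂ} {α L : ℂ} (hc : ContinuousOn h (Ioi 0))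
    (hL : Tendsto (fun w : ℝ => h w * (w : ℂ) ^ (-α) * Complex.exp w) atTop (nhds L)) :
    IsExpDecaying h := by
  refine ⟨hc, fun w₀ hw₀ => ?_⟩
  have h1 : Tendsto (fun w : ℝ => h w * Complex.exp ((w / 2 : ℝ) : ℂ)) atTop (nhds 0) := by
    have := hL.mul (tendsto_cpow_mul_cexp_neg_mul α (1 / 2) (by norm_num))
    rw [mul_zero] at this
    refine this.congr' ?_
    filter_upwards [eventually_gt_atTop 0] with w hw
    have hw' : (w : ℂ) ≠ 0 := by exact_mod_cast hw.ne'
    have e : Complex.exp ((w / 2 : ℝ) : ℂ) =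
        Complex.exp w * Complex.exp (-((1 / 2 : ℝ) : ℂ) * w) := by
      rw [← Complex.exp_add]; push_cast; congr 1; ring
    have hwa : (w : ℂ) ^ α ≠ 0 := by simp [Complex.cpow_eq_zero_iff, hw']
    rw [e, Complex.cpow_neg]
    field_simp
  obtain ⟨A, hA⟩ := eventually_atTop.1 (h1.norm.eventually_le_const (u := 1) (by simp))
  have hcc : ContinuousOn (fun w : ℝ => h w * Complex.exp ((w / 2 : ℝ) : ℂ)) (Icc w₀ A) :=
    (hc.mono fun w hw => hw₀.trans_le hw.1).mul (by fun_prop)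
  obtain ⟨K, hK⟩ := isCompact_Icc.exists_bound_of_continuousOn hcc
  refine ⟨max 1 K, by positivity, fun w hw => ?_⟩
  have hb : ‖h w * Complex.exp ((w / 2 : ℝ) : ℂ)‖ ≤ max 1 K := by
    rcases le_total A w with hAw | hAw
    · exact (hA w hAw).trans (le_max_left _ _)
    · exact (hK w ⟨hw, hAw⟩).trans (le_max_right _ _)
  rw [norm_mul, Complex.norm_exp, Complex.ofReal_re] at hb
  rw [Real.exp_neg, ← div_eq_mul_inv, le_div_iff₀ (Real.exp_pos _)]
  exact hb

theorem IsExpDecaying.continuous_comp {h : ℝ → ℂ} (hh : IsExpDecaying h) {S : ℝ} (hS : 0 < S) :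
    Continuous fun θ : ℝ => h (S * Real.cosh (θ / 2) ^ 2) :=
  hh.1.comp_continuous (by fun_prop) fun θ => by
    have := Real.cosh_pos (θ / 2)
    simp only [mem_Ioi]; positivity

/-- Combines the exponential decay with cosh²(θ/2) ≥ 1 + θ²/4. The bound is uniform in S ≥ S₀, so it
can dominate a whole neighbourhood of parameters. -/
theorem IsExpDecaying.exists_bound {h : ℝ → ℂ} (hh : IsExpDecaying h) {S₀ : ℝ} (hS : 0 < S₀) :
    ∃ C : ℝ, 0 ≤ C ∧ ∀ S θ : ℝ, S₀ ≤ S → ‖h (S * Real.cosh (θ / 2) ^ 2)‖ ≤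
      C * Real.exp (-(S₀ / 8 * θ ^ 2)) := by
  obtain ⟨C, hC, hb⟩ := hh.2 S₀ hS
  refine ⟨C, hC, fun S θ hSS => ?_⟩
  have h1 := one_add_sq_le_sq_cosh_half θ
  have h2 : S₀ * (1 + θ ^ 2 / 4) ≤ S * Real.cosh (θ / 2) ^ 2 :=
    mul_le_mul hSS h1 (by positivity) (by linarith)
  refine (hb _ (by nlinarith [sq_nonneg θ])).trans ?_
  gcongr
  linarith

theorem IsExpDecaying.integrable_mul_comp {h m : ℝ → ℂ} (hh : IsExpDecaying h)
    (hm : Continuous m) {A : ℝ} (hA : ∀ θ, ‖m θ‖ ≤ Real.exp (A * |θ|)) {S : ℝ} (hS : 0 < S) :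
    Integrable fun θ : ℝ => m θ * h (S * Real.cosh (θ / 2) ^ 2) := by
  obtain ⟨C, hC, hb⟩ := hh.exists_bound hS
  refine ((integrable_exp_mul_abs_sub_sq A (b := S / 8) (by positivity)).const_mul C).mono'
    (hm.mul (hh.continuous_comp hS)).aestronglyMeasurable (Eventually.of_forall fun θ => ?_)
  rw [norm_mul, sub_eq_add_neg, Real.exp_add]
  calc _ ≤ Real.exp (A * |θ|) * (C * Real.exp (-(S / 8 * θ ^ 2))) :=
        mul_le_mul (hA θ) (hb S θ le_rfl) (norm_nonneg _) (Real.exp_pos _).le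
    _ = _ := by ring

theorem norm_mul_sq_cosh_half_le {m : ℝ → ℂ} {A : ℝ} (hA : ∀ θ, ‖m θ‖ ≤ Real.exp (A * |θ|))
    (θ : ℝ) : ‖m θ * (Real.cosh (θ / 2) ^ 2 : ℝ)‖ ≤ Real.exp ((A + 1) * |θ|) := by
  rw [norm_mul, Complex.norm_real, Real.norm_of_nonneg (by positivity), add_mul, Real.exp_add,
    one_mul]
  exact mul_le_mul (hA θ) (sq_cosh_half_le θ) (by positivity) (Real.exp_pos _).le

/-- Differentiating in S brings down cosh²(θ/2) ≤ e^{|θ|}, which only raises the exponential growth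
rate A by 1; the Gaussian bound still dominates. -/
theorem IsExpDecaying.hasDerivAt_integral {h h' m : ℝ → ℂ} (hh : IsExpDecaying h)
    (hh' : IsExpDecaying h') (hd : ∀ w : ℝ, 0 < w → HasDerivAt h (h' w) w)
    (hm : Continuous m) {A : ℝ} (hA : ∀ θ, ‖m θ‖ ≤ Real.exp (A * |θ|)) {S : ℝ} (hS : 0 < S) :
    HasDerivAt (fun S : ℝ => ∫ θ : ℝ, m θ * h (S * Real.cosh (θ / 2) ^ 2))
      (∫ θ : ℝ, m θ * (Real.cosh (θ / 2) ^ 2 : ℝ) * h' (S * Real.cosh (θ / 2) ^ 2)) S := by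
  have hS2 : 0 < S / 2 := by positivity
  obtain ⟨C, hC, hb⟩ := hh'.exists_bound hS2
  refine (hasDerivAt_integral_of_dominated_loc_of_deriv_le (𝕜 := ℝ) (x₀ := S)
    (F := fun (S : ℝ) θ => m θ * h (S * Real.cosh (θ / 2) ^ 2))
    (F' := fun (S : ℝ) θ => m θ * (Real.cosh (θ / 2) ^ 2 : ℝ) * h' (S * Real.cosh (θ / 2) ^ 2))
    (bound := fun θ => C * Real.exp ((A + 1) * |θ| - S / 2 / 8 * θ ^ 2))
    (isOpen_Ioi.mem_nhds (show S ∈ Ioi (S / 2) by simpa using hS)) ?_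
    (hh.integrable_mul_comp hm hA hS) ?_ ?_
    ((integrable_exp_mul_abs_sub_sq (A + 1) (by positivity)).const_mul C) ?_).2
  · filter_upwards [eventually_gt_nhds hS] with T hT
    exact (hm.mul (hh.continuous_comp hT)).aestronglyMeasurable
  · refine ((hm.mul ?_).mul (hh'.continuous_comp hS)).aestronglyMeasurable
    fun_prop
  · refine Eventually.of_forall fun θ T hT => ?_
    rw [norm_mul, sub_eq_add_neg, Real.exp_add]
    calc _ ≤ Real.exp ((A + 1) * |θ|) * (C * Real.exp (-(S / 2 / 8 * θ ^ 2))) :=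
          mul_le_mul (norm_mul_sq_cosh_half_le hA θ) (hb T θ (le_of_lt hT)) (norm_nonneg _)
            (Real.exp_pos _).le
      _ = _ := by ring
  · refine Eventually.of_forall fun θ T hT => ?_
    have hT0 : 0 < T := hS2.trans hT
    have hc := Real.cosh_pos (θ / 2)
    have h1 := (hd (T * Real.cosh (θ / 2) ^ 2) (by positivity)).scomp T
      ((hasDerivAt_id T).mul_const (Real.cosh (θ / 2) ^ 2))
    refine (h1.const_mul (m θ)).congr_deriv ?_
    rw [one_mul, Complex.real_smul]; ring

theorem norm_cexp_ofReal_mul_le (ν : ℂ) (θ : ℝ) :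
    ‖Complex.exp (ν * θ)‖ ≤ Real.exp (‖ν‖ * |θ|) := by
  refine (Complex.norm_exp_le_exp_norm _).trans ?_
  rw [norm_mul, Complex.norm_real, Real.norm_eq_abs]

/-! ### The θ-integral: differential equation in S and behaviour at infinity. -/

namespace IsDecayingSolution

variable {α : ℂ} {g g' : ℝ → ℂ}

theorem isExpDecaying (h : IsDecayingSolution α g g') : IsExpDecaying g :=
  isExpDecaying_of_tendsto
    (fun w hw => (h.hasDerivAt w hw).continuousAt.continuousWithinAt) h.tendsto

theorem isExpDecaying_deriv (h : IsDecayingSolution α g g') : IsExpDecaying g' :=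
  isExpDecaying_of_tendsto
    (fun w hw => (h.hasDerivAt' w hw).continuousAt.continuousWithinAt) h.tendsto'

theorem isExpDecaying_deriv_two (h : IsDecayingSolution α g g') :
    IsExpDecaying fun w => -((w + 1 / 2) * g' w + (1 / 2 + α) * g w) / w := by
  refine isExpDecaying_of_tendsto (α := α) (L := 1) ?_ ?_
  · refine ContinuousOn.div (ContinuousOn.neg (ContinuousOn.add (ContinuousOn.mul (by fun_prop)
      h.isExpDecaying_deriv.1) (continuousOn_const.mul h.isExpDecaying.1))) (by fun_prop)
      fun w hw => ?_
    exact_mod_cast (ne_of_gt hw)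
  · have hinv : Tendsto (fun x : ℝ => ((x : ℂ))⁻¹) atTop (nhds 0) := by
      have := (Complex.continuous_ofReal.tendsto 0).comp tendsto_inv_atTop_zero
      simpa [Function.comp_def] using this
    have := (h.tendsto'.add ((hinv.mul h.tendsto').const_mul (1 / 2))).add
      ((hinv.mul h.tendsto).const_mul (1 / 2 + α)) |>.neg
    simp only [zero_mul, mul_zero, add_zero, neg_neg] at this
    refine this.congr' ?_
    filter_upwards [eventually_gt_atTop 0] with w hw
    have hw' : (w : ℂ) ≠ 0 := by exact_mod_cast hw.ne'
    field_simp

/-- Integration by parts for `∫ e^{νθ} g(S cosh²(θ/2)) dθ`. -/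
theorem integral_ode (h : IsDecayingSolution α g g') (ν : ℂ) {S : ℝ} (hS : 0 < S) :
    (S : ℂ) ^ 2 * (∫ θ : ℝ, Complex.exp (ν * θ) * (Real.cosh (θ / 2) ^ 2 : ℝ) *
        (Real.cosh (θ / 2) ^ 2 : ℝ) *
        (fun w : ℝ => -((w + 1 / 2) * g' w + (1 / 2 + α) * g w) / w) (S * Real.cosh (θ / 2) ^ 2)) +
      (S + S ^ 2) * (∫ θ : ℝ, Complex.exp (ν * θ) * (Real.cosh (θ / 2) ^ 2 : ℝ) *
        g' (S * Real.cosh (θ / 2) ^ 2)) +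
      ((1 / 2 + α) * S - ν ^ 2) *
        ∫ θ : ℝ, Complex.exp (ν * θ) * g (S * Real.cosh (θ / 2) ^ 2) = 0 := by
  have hm : Continuous fun θ : ℝ => Complex.exp (ν * θ) := by fun_prop
  have hm1 : Continuous fun θ : ℝ => Complex.exp (ν * θ) * (Real.cosh (θ / 2) ^ 2 : ℝ) := by
    fun_prop
  have hm2 : Continuous fun θ : ℝ => Complex.exp (ν * θ) * (Real.cosh (θ / 2) ^ 2 : ℝ) *
      (Real.cosh (θ / 2) ^ 2 : ℝ) := by fun_prop
  have hA := norm_cexp_ofReal_mul_le ν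
  have i0 := h.isExpDecaying.integrable_mul_comp hm hA hS
  have i1 := h.isExpDecaying_deriv.integrable_mul_comp hm1 (norm_mul_sq_cosh_half_le hA) hS
  have i2 := h.isExpDecaying_deriv_two.integrable_mul_comp hm2
    (norm_mul_sq_cosh_half_le (norm_mul_sq_cosh_half_le hA)) hS
  have i3 := h.isExpDecaying_deriv.integrable_mul_comp
    (m := fun θ : ℝ => Complex.exp (ν * θ) * (Real.sinh (θ / 2) * Real.cosh (θ / 2) : ℝ))
    (A := ‖ν‖ + 1) (by fun_prop) (fun θ => by
      rw [norm_mul, Complex.norm_real, Real.norm_eq_abs, add_mul, Real.exp_add, one_mul]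
      exact mul_le_mul (hA θ) (abs_sinh_mul_cosh_half_le θ) (abs_nonneg _) (Real.exp_pos _).le) hS
  have e := integral_add ((i2.const_mul ((S : ℂ) ^ 2)).add (i1.const_mul ((S : ℂ) + S ^ 2)))
    (i0.const_mul ((1 / 2 + α) * S - ν ^ 2))
  simp only [Pi.add_apply] at e
  rw [integral_add (i2.const_mul _) (i1.const_mul _), integral_const_mul, integral_const_mul,
    integral_const_mul] at e
  rw [← e]
  -- An explicit primitive of the combined integrand. It is itself integrable over ℝ, so the
  -- integral of its derivative is zero without a separate boundary computation.
  refine integral_eq_zero_of_hasDerivAt_of_integrable (f := fun θ : ℝ =>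
      S * (Complex.exp (ν * θ) * (Real.sinh (θ / 2) * Real.cosh (θ / 2) : ℝ) *
        g' (S * Real.cosh (θ / 2) ^ 2)) -
      ν * (Complex.exp (ν * θ) * g (S * Real.cosh (θ / 2) ^ 2))) (fun θ => ?_)
    (((i2.const_mul _).add (i1.const_mul _)).add (i0.const_mul _))
    ((i3.const_mul _).sub (i0.const_mul _))
  have hc := Real.cosh_pos (θ / 2)
  have hw : 0 < S * Real.cosh (θ / 2) ^ 2 := by positivity
  have dh : HasDerivAt (fun θ : ℝ => θ / 2) (1 / 2) θ := (hasDerivAt_id θ).div_const 2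
  have dsh := dh.sinh
  have dch := dh.cosh
  have dw := (dch.pow 2).const_mul S
  have d0 := (h.hasDerivAt _ hw).scomp θ dw
  have d1 := (h.hasDerivAt' _ hw).scomp θ dw
  have de : HasDerivAt (fun θ : ℝ => Complex.exp (ν * θ)) (Complex.exp (ν * θ) * ν) θ := by
    have := ((hasDerivAt_id (θ : ℂ)).const_mul ν).cexp.comp_ofReal
    simpa using this
  have ds := (dsh.mul dch).ofReal_comp
  refine ((((de.mul ds).mul d1).const_mul (S : ℂ)).sub
    ((de.mul d0).const_mul ν)).congr_deriv ?_
  have hsq := Real.cosh_sq (θ / 2)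
  have hc' : (Real.cosh (θ / 2) : ℂ) ≠ 0 := by exact_mod_cast hc.ne'
  have hS' : (S : ℂ) ≠ 0 := by exact_mod_cast hS.ne'
  have hsq' : (Real.sinh (θ / 2) : ℂ) ^ 2 = (Real.cosh (θ / 2) : ℂ) ^ 2 - 1 := by
    rw [← Complex.ofReal_pow, ← Complex.ofReal_pow, hsq]; push_cast; ring
  simp only [Complex.real_smul, Pi.mul_apply, Pi.pow_apply, Function.comp_apply]
  generalize Real.cosh (θ / 2) = c at *
  generalize Real.sinh (θ / 2) = s at *
  generalize g (S * c ^ 2) = G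
  generalize g' (S * c ^ 2) = G'
  generalize Complex.exp (ν * θ) = e
  push_cast
  field_simp
  ring_nf
  simp only [hsq']
  ring

/-- Laplace's method: since cosh² = 1 + sinh², a factor e^{-S} splits off, and θ = φ/√S turns the
rest into an integral converging to ∫ e^{-φ²/4} dφ = 2√π. -/
theorem integral_tendsto (h : IsDecayingSolution α g g') (ν : ℂ) :
    Tendsto (fun S : ℝ => (∫ θ : ℝ, Complex.exp (ν * θ) * g (S * Real.cosh (θ / 2) ^ 2)) *
      (S : ℂ) ^ (1 / 2 - α) * Complex.exp S) atTop (nhds (2 * Real.sqrt Real.pi : ℝ)) := by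
  set r : ℝ → ℂ := fun w => g w * (w : ℂ) ^ (-α) * Complex.exp w with hr
  have hrc : ContinuousOn r (Ioi 0) :=
    (h.isExpDecaying.1.mul (continuousOn_ofReal_cpow _)).mul (by fun_prop)
  obtain ⟨A, hA⟩ := eventually_atTop.1 (h.tendsto.norm.eventually_le_const (u := 2) (by simp))
  have hgauss : ∫ φ : ℝ, ((Real.exp (-(1 / 4) * φ ^ 2) : ℝ) : ℂ) =
      (2 * Real.sqrt Real.pi : ℝ) := by
    rw [integral_complex_ofReal, integral_gaussian]
    congr 1
    rw [show Real.pi / (1 / 4) = 2 ^ 2 * Real.pi by ring, Real.sqrt_mul (by norm_num),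
      Real.sqrt_sq (by norm_num)]
  rw [← hgauss]
  have key : Tendsto (fun S : ℝ => ∫ φ : ℝ, Complex.exp (ν * (φ / Real.sqrt S : ℝ)) *
      r (S * Real.cosh (φ / Real.sqrt S / 2) ^ 2) *
      ((Real.cosh (φ / Real.sqrt S / 2) ^ 2 : ℝ) : ℂ) ^ α *
      (Real.exp (-(S * Real.sinh (φ / Real.sqrt S / 2) ^ 2)) : ℝ)) atTop
      (nhds (∫ φ : ℝ, ((Real.exp (-(1 / 4) * φ ^ 2) : ℝ) : ℂ))) := by
    refine tendsto_integral_filter_of_dominated_convergence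
      (fun φ => 2 * Real.exp ((‖ν‖ + |α.re|) * |φ| - 1 / 4 * φ ^ 2)) ?_ ?_
      ((integrable_exp_mul_abs_sub_sq _ (by norm_num)).const_mul 2) ?_
    · filter_upwards [eventually_gt_atTop 0] with S hS
      refine Continuous.aestronglyMeasurable ?_
      have hp : ∀ φ : ℝ, 0 < Real.cosh (φ / Real.sqrt S / 2) ^ 2 := fun φ =>
        pow_pos (Real.cosh_pos _) 2
      refine ((Continuous.mul (by fun_prop) ?_).mul ?_).mul (by fun_prop)
      · exact hrc.comp_continuous (by fun_prop) fun φ => mul_pos hS (hp φ)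
      · exact (continuousOn_ofReal_cpow α).comp_continuous
          (f := fun φ : ℝ => Real.cosh (φ / Real.sqrt S / 2) ^ 2) (by fun_prop) hp
    -- S ≥ 1 gives |φ/√S| ≤ |φ|, which makes the exponential factors uniform in S, and S ≥ A bounds
    -- the normalised g by 2. The Gaussian factor comes from S sinh²(φ/(2√S)) ≥ φ²/4.
    · filter_upwards [eventually_ge_atTop A, eventually_ge_atTop 1] with S hSA hS1
      refine Eventually.of_forall fun φ => ?_
      have hsq1 : 1 ≤ Real.sqrt S := Real.one_le_sqrt.2 hS1
      have habs : |φ / Real.sqrt S| ≤ |φ| := by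
        rw [abs_div, abs_of_pos (by linarith : 0 < Real.sqrt S)]
        exact div_le_self (abs_nonneg _) hsq1
      have hc1 := one_le_sq_cosh_half (φ / Real.sqrt S)
      have b1 : ‖Complex.exp (ν * (φ / Real.sqrt S : ℝ))‖ ≤ Real.exp (‖ν‖ * |φ|) :=
        (norm_cexp_ofReal_mul_le _ _).trans (by gcongr)
      have b2 : ‖r (S * Real.cosh (φ / Real.sqrt S / 2) ^ 2)‖ ≤ 2 :=
        hA _ (hSA.trans (by nlinarith))
      have b3 : ‖((Real.cosh (φ / Real.sqrt S / 2) ^ 2 : ℝ) : ℂ) ^ α‖ ≤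
          Real.exp (|α.re| * |φ|) := by
        rw [Complex.norm_cpow_eq_rpow_re_of_pos (by linarith)]
        calc _ ≤ (Real.cosh (φ / Real.sqrt S / 2) ^ 2) ^ |α.re| :=
              Real.rpow_le_rpow_of_exponent_le hc1 (le_abs_self _)
          _ ≤ (Real.exp |φ|) ^ |α.re| := by
              refine Real.rpow_le_rpow (by linarith) ?_ (abs_nonneg _)
              exact (sq_cosh_half_le _).trans (Real.exp_le_exp.2 habs)
          _ = _ := by rw [← Real.exp_mul, mul_comm]
      have b4 : ‖((Real.exp (-(S * Real.sinh (φ / Real.sqrt S / 2) ^ 2)) : ℝ) : ℂ)‖ ≤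
          Real.exp (-(1 / 4 * φ ^ 2)) := by
        rw [Complex.norm_real, Real.norm_of_nonneg (Real.exp_pos _).le]
        refine Real.exp_le_exp.2 (neg_le_neg ?_)
        have h1 := one_add_sq_le_sq_cosh_half (φ / Real.sqrt S)
        rw [sq_cosh_half_eq, div_pow, Real.sq_sqrt (by linarith)] at h1
        have h2 : S * (φ ^ 2 / S / 4) ≤ S * Real.sinh (φ / Real.sqrt S / 2) ^ 2 := by
          gcongr
          linarith
        refine le_trans (le_of_eq ?_) h2
        field_simp
      rw [norm_mul, norm_mul, norm_mul]
      calc _ ≤ Real.exp (‖ν‖ * |φ|) * 2 * Real.exp (|α.re| * |φ|) *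
            Real.exp (-(1 / 4 * φ ^ 2)) := by gcongr
        _ = _ := by rw [sub_eq_add_neg, Real.exp_add, add_mul, Real.exp_add]; ring
    · refine Eventually.of_forall fun φ => ?_
      have hsq : Tendsto (fun S : ℝ => Real.sqrt S) atTop atTop := Real.tendsto_sqrt_atTop
      have hz : Tendsto (fun S : ℝ => φ / Real.sqrt S) atTop (nhds 0) :=
        tendsto_const_nhds.div_atTop hsq
      have l1 : Tendsto (fun S : ℝ => Complex.exp (ν * (φ / Real.sqrt S : ℝ))) atTop (nhds 1) := by
        have hc : Continuous fun x : ℝ => Complex.exp (ν * x) := by fun_prop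
        simpa [Function.comp_def] using (hc.tendsto 0).comp hz
      have l2 : Tendsto (fun S : ℝ => r (S * Real.cosh (φ / Real.sqrt S / 2) ^ 2)) atTop
          (nhds 1) := by
        refine h.tendsto.comp (tendsto_atTop_mono' _ ?_ tendsto_id)
        filter_upwards [eventually_ge_atTop 0] with S hS
        exact le_mul_of_one_le_right hS (one_le_sq_cosh_half _)
      have l3 : Tendsto (fun S : ℝ => ((Real.cosh (φ / Real.sqrt S / 2) ^ 2 : ℝ) : ℂ) ^ α) atTop
          (nhds 1) := by
        have hc : ContinuousAt (fun x : ℝ => ((Real.cosh (x / 2) ^ 2 : ℝ) : ℂ) ^ α) 0 := by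
          refine ContinuousAt.cpow (by fun_prop) continuousAt_const (by simp)
        simpa [Function.comp_def] using hc.tendsto.comp hz
      have l4 : Tendsto (fun S : ℝ => ((Real.exp (-(S * Real.sinh (φ / Real.sqrt S / 2) ^ 2)) : ℝ) : ℂ))
          atTop (nhds ((Real.exp (-(1 / 4) * φ ^ 2) : ℝ) : ℂ)) := by
        -- √S sinh(φ/(2√S)) is the difference quotient of this function at 0 with step 1/√S, so it
        -- tends to φ/2.
        have hd : HasDerivAt (fun x : ℝ => Real.sinh (φ * x / 2)) (φ / 2) 0 := by
          have := (((hasDerivAt_id (0 : ℝ)).const_mul φ).div_const 2).sinh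
          simpa using this
        have hi : Tendsto (fun S : ℝ => (Real.sqrt S)⁻¹) atTop (nhdsWithin 0 {0}ᶜ) := by
          refine tendsto_nhdsWithin_iff.2 ⟨tendsto_inv_atTop_zero.comp hsq, ?_⟩
          filter_upwards [eventually_gt_atTop 0] with S hS
          simpa using (Real.sqrt_pos.2 hS).ne'
        have hs := hd.tendsto_slope_zero.comp hi
        have hs2 := (hs.pow 2).neg
        have hs3 := ((Complex.continuous_ofReal.comp Real.continuous_exp).tendsto _).comp hs2
        have e : -(1 / 4) * φ ^ 2 = -(φ / 2) ^ 2 := by ring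
        rw [e]
        refine hs3.congr' ?_
        filter_upwards [eventually_gt_atTop 0] with S hS
        simp only [Function.comp_apply, zero_add, mul_zero, zero_div, Real.sinh_zero, sub_zero,
          inv_inv, smul_eq_mul, mul_pow, Real.sq_sqrt hS.le]
        rw [div_eq_mul_inv φ]
      simpa using ((l1.mul l2).mul l3).mul l4
  refine key.congr' ?_
  filter_upwards [eventually_gt_atTop 0] with S hS
  have hS' : (S : ℂ) ≠ 0 := by exact_mod_cast hS.ne'
  have hsc := Measure.integral_comp_div
    (fun θ : ℝ => Complex.exp (ν * θ) * g (S * Real.cosh (θ / 2) ^ 2)) (Real.sqrt S)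
  rw [abs_of_pos (Real.sqrt_pos.2 hS), Complex.real_smul] at hsc
  have hsqrt : (S : ℂ) ^ (1 / 2 - α) = (Real.sqrt S : ℂ) * (S : ℂ) ^ (-α) := by
    rw [Real.sqrt_eq_rpow, Complex.ofReal_cpow hS.le, ← Complex.cpow_add _ _ hS']
    congr 1
    push_cast; ring
  refine Eq.trans ?_ (show ((S : ℂ) ^ (-α) * Complex.exp S) * ((Real.sqrt S : ℂ) *
    ∫ θ : ℝ, Complex.exp (ν * θ) * g (S * Real.cosh (θ / 2) ^ 2)) = _ by rw [hsqrt]; ring)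
  rw [← hsc, ← integral_const_mul]
  refine integral_congr_ae (Eventually.of_forall fun φ => ?_)
  have hc : 0 < Real.cosh (φ / Real.sqrt S / 2) ^ 2 := pow_pos (Real.cosh_pos _) 2
  have hc' : ((Real.cosh (φ / Real.sqrt S / 2) ^ 2 : ℝ) : ℂ) ≠ 0 := by exact_mod_cast hc.ne'
  have hca : ((Real.cosh (φ / Real.sqrt S / 2) ^ 2 : ℝ) : ℂ) ^ α ≠ 0 := by
    rw [Complex.cpow_def_of_ne_zero hc']; exact Complex.exp_ne_zero _
  have e1 : ((S * Real.cosh (φ / Real.sqrt S / 2) ^ 2 : ℝ) : ℂ) ^ (-α) = (S : ℂ) ^ (-α) *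
      (((Real.cosh (φ / Real.sqrt S / 2) ^ 2 : ℝ) : ℂ) ^ α)⁻¹ := by
    rw [Complex.ofReal_mul, Complex.mul_cpow_ofReal_nonneg hS.le hc.le,
      Complex.cpow_neg ((Real.cosh (φ / Real.sqrt S / 2) ^ 2 : ℝ) : ℂ)]
  have e2 : Complex.exp ((S * Real.cosh (φ / Real.sqrt S / 2) ^ 2 : ℝ) : ℂ) *
      ((Real.exp (-(S * Real.sinh (φ / Real.sqrt S / 2) ^ 2)) : ℝ) : ℂ) = Complex.exp S := by
    rw [Complex.ofReal_exp, ← Complex.exp_add, ← Complex.ofReal_add, sq_cosh_half_eq]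
    congr 2; ring
  simp only [hr]
  rw [e1, ← e2]
  generalize Real.cosh (φ / Real.sqrt S / 2) = c at *
  field_simp

end IsDecayingSolution

/-! ### The kernel and the Whittaker function in terms of g. -/

namespace IsDecayingSolution

variable {α : ℂ} {g g' : ℝ → ℂ}

/-- For p = ν = 1/4 the constant p² - p + 1/4 - ν² vanishes, so the equation for Φ is x times the
one satisfied by g. -/
theorem isWhittakerW_quarter (h : IsDecayingSolution α g g') :
    IsWhittakerW (α + 1 / 4) (1 / 4)
      fun x => (x : ℂ) ^ (1 / 4 : ℂ) * Complex.exp ((x : ℂ) / 2) * g x := by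
  refine isWhittakerW_cpow_mul_exp_mul (fun x hx =>
    ⟨h.hasDerivAt x hx, h.hasDerivAt' x hx, ?_⟩) (h.tendsto.congr fun x => ?_)
  · have hx' : (x : ℂ) ≠ 0 := by exact_mod_cast hx.ne'
    field_simp
    ring
  · rw [show (1 / 4 : ℂ) - (α + 1 / 4) = -α by ring]

/-- An integral representation of the Whittaker function. -/
theorem isWhittakerW_integral (h : IsDecayingSolution α g g') (ν : ℂ) :
    IsWhittakerW α ν fun S => (S : ℂ) ^ (1 / 2 : ℂ) * Complex.exp ((S : ℂ) / 2) *
      (((2 * Real.sqrt Real.pi : ℝ) : ℂ)⁻¹ *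
        ∫ θ : ℝ, Complex.exp (ν * θ) * g (S * Real.cosh (θ / 2) ^ 2)) := by
  have hm : Continuous fun θ : ℝ => Complex.exp (ν * θ) := by fun_prop
  have hm1 : Continuous fun θ : ℝ => Complex.exp (ν * θ) * (Real.cosh (θ / 2) ^ 2 : ℝ) := by
    fun_prop
  have hA := norm_cexp_ofReal_mul_le ν
  refine isWhittakerW_cpow_mul_exp_mul (fun S hS =>
    ⟨(h.isExpDecaying.hasDerivAt_integral h.isExpDecaying_deriv h.hasDerivAt hm hA hS).const_mul _,
      (h.isExpDecaying_deriv.hasDerivAt_integral h.isExpDecaying_deriv_two h.hasDerivAt' hm1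
        (norm_mul_sq_cosh_half_le hA) hS).const_mul _, ?_⟩) ?_
  · linear_combination ((2 * Real.sqrt Real.pi : ℝ) : ℂ)⁻¹ * h.integral_ode ν hS
  · have hπ : ((2 * Real.sqrt Real.pi : ℝ) : ℂ) ≠ 0 := by
      have := Real.sqrt_pos.2 Real.pi_pos
      exact_mod_cast (by positivity : 2 * Real.sqrt Real.pi ≠ 0)
    have := (h.integral_tendsto ν).const_mul ((2 * Real.sqrt Real.pi : ℝ) : ℂ)⁻¹
    rw [inv_mul_cancel₀ hπ] at this
    refine this.congr fun S => ?_
    ring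

theorem parabolicCylinderD_eq (h : IsDecayingSolution α g g') {z : ℝ} (hz : 0 < z) :
    parabolicCylinderD (2 * α) z =
      (2 : ℂ) ^ α * Complex.exp ((z ^ 2 / 4 : ℝ) : ℂ) * g (z ^ 2 / 2) := by
  have hw : 0 < z ^ 2 / 2 := by positivity
  have e : 2 * α / 2 + 1 / 4 = α + 1 / 4 := by ring
  rw [parabolicCylinderD, e, h.isWhittakerW_quarter.whittakerW_eq hw]
  have hz' : (z : ℂ) ≠ 0 := by exact_mod_cast hz.ne'
  have e1 : ((z ^ 2 / 2 : ℝ) : ℂ) ^ (1 / 4 : ℂ) =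
      (z : ℂ) ^ (1 / 2 : ℂ) * ((2 : ℂ) ^ (1 / 4 : ℂ))⁻¹ := by
    have hl : Real.log (z ^ 2 / 2) = 2 * Real.log z - Real.log 2 := by
      rw [Real.log_div (by positivity) (by norm_num), Real.log_pow]; norm_num
    have hl2 : Complex.log 2 = (Real.log 2 : ℝ) := by
      rw [Complex.ofReal_log (by norm_num)]; norm_num
    rw [Complex.cpow_def_of_ne_zero (by exact_mod_cast hw.ne'),
      Complex.cpow_def_of_ne_zero hz', Complex.cpow_def_of_ne_zero two_ne_zero,
      ← Complex.exp_neg, ← Complex.exp_add, ← Complex.ofReal_log hw.le, ← Complex.ofReal_log hz.le,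
      hl, hl2]
    push_cast
    congr 1; ring
  have e2 : Complex.exp (((z ^ 2 / 2 : ℝ) : ℂ) / 2) = Complex.exp ((z ^ 2 / 4 : ℝ) : ℂ) := by
    congr 1; push_cast; ring
  have e3 : (2 : ℂ) ^ (1 / 4 : ℂ) ≠ 0 := by simp [Complex.cpow_eq_zero_iff]
  have e4 : (z : ℂ) ^ (1 / 2 : ℂ) ≠ 0 := by simp [Complex.cpow_eq_zero_iff, hz']
  rw [e1, e2, Complex.cpow_add _ _ two_ne_zero, Complex.cpow_neg]
  field_simp

/-- The factor e^{z²/4} in D cancels the quadratic exponential of the kernel, e^ξ cancels against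
the weight, and the powers of 2 collapse to 1/2. -/
theorem cpow_mul_whittakerKernel_mul_whittakerWeight {a : ℂ}
    (h : IsDecayingSolution (1 / 2 - a) g g') (β : ℂ) {x y ξ : ℝ} (hx : 0 < x) (hy : 0 < y)
    (hξ : 0 < ξ) :
    (ξ : ℂ) ^ β * whittakerKernel a x y ξ * whittakerWeight a ξ =
      ((2 * Real.sqrt Real.pi : ℝ) : ℂ)⁻¹ * ((x * y : ℝ) : ℂ) ^ a *
        Complex.exp ((x + y : ℝ) : ℂ) * ((ξ : ℂ) ^ (β - a) / ξ *
          g ((x * y + x * ξ + y * ξ) ^ 2 / (4 * (x * y) * ξ))) := by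
  have hp : 0 < 2 * x * y * ξ := by positivity
  have hz : 0 < (x * y + x * ξ + y * ξ) / Real.sqrt (2 * x * y * ξ) :=
    div_pos (by positivity) (Real.sqrt_pos.2 hp)
  have hξ' : (ξ : ℂ) ≠ 0 := by exact_mod_cast hξ.ne'
  have ez : ((x * y + x * ξ + y * ξ) / Real.sqrt (2 * x * y * ξ)) ^ 2 =
      (x * y + x * ξ + y * ξ) ^ 2 / (2 * x * y * ξ) := by
    rw [div_pow, Real.sq_sqrt hp.le]
  have e1 : (1 : ℂ) - 2 * a = 2 * (1 / 2 - a) := by ring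
  rw [whittakerKernel, whittakerWeight, e1, h.parabolicCylinderD_eq hz, ez]
  have ew : (x * y + x * ξ + y * ξ) ^ 2 / (2 * x * y * ξ) / 2 =
      (x * y + x * ξ + y * ξ) ^ 2 / (4 * (x * y) * ξ) := by
    field_simp; norm_num
  rw [ew]
  have e2 : (2 : ℂ) ^ (-(3 / 2) + a) * (2 : ℂ) ^ (1 / 2 - a) = (2 : ℂ)⁻¹ := by
    rw [← Complex.cpow_add _ _ two_ne_zero, ← Complex.cpow_neg_one]
    congr 1; ring
  have e3 : Complex.exp ((x + y + ξ - (x * y + x * ξ + y * ξ) ^ 2 / (8 * x * y * ξ) : ℝ) : ℂ) *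
      Complex.exp (((x * y + x * ξ + y * ξ) ^ 2 / (2 * x * y * ξ) / 4 : ℝ) : ℂ) *
      Complex.exp (-(ξ : ℂ)) = Complex.exp ((x + y : ℝ) : ℂ) := by
    rw [← Complex.exp_add, ← Complex.exp_add, ← Complex.ofReal_add, ← Complex.ofReal_neg,
      ← Complex.ofReal_add]
    congr 2
    field_simp
    ring
  have e4 : ((x * y * ξ : ℝ) : ℂ) ^ a = ((x * y : ℝ) : ℂ) ^ a * (ξ : ℂ) ^ a := by
    rw [Complex.ofReal_mul (x * y), Complex.mul_cpow_ofReal_nonneg (by positivity) hξ.le]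
  have e5 : (ξ : ℂ) ^ β * (ξ : ℂ) ^ a * (ξ : ℂ) ^ (-2 * a - 1) = (ξ : ℂ) ^ (β - a) / ξ := by
    rw [← Complex.cpow_add _ _ hξ', ← Complex.cpow_add _ _ hξ', div_eq_mul_inv,
      ← Complex.cpow_neg_one, ← Complex.cpow_add _ _ hξ']
    congr 1; ring
  have e6 : ((Real.pi : ℝ) : ℂ) ^ (-(1 / 2) : ℂ) = ((Real.sqrt Real.pi : ℝ) : ℂ)⁻¹ := by
    rw [Complex.cpow_neg, Real.sqrt_eq_rpow, Complex.ofReal_cpow Real.pi_pos.le]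
    push_cast; rfl
  rw [e4, e6, ← e5, ← e3]
  have e7 : ((2 * Real.sqrt Real.pi : ℝ) : ℂ)⁻¹ =
      (2 : ℂ) ^ (-(3 / 2) + a) * (2 : ℂ) ^ (1 / 2 - a) * ((Real.sqrt Real.pi : ℝ) : ℂ)⁻¹ := by
    rw [e2]; push_cast; rw [mul_inv]
  rw [e7]
  ring

end IsDecayingSolution

/-! ### The substitution and the product formula. -/

theorem image_mul_exp_univ {c : ℝ} (hc : 0 < c) :
    (fun θ : ℝ => c * Real.exp θ) '' univ = Ioi 0 := by
  ext ξ
  simp only [image_univ, mem_range, mem_Ioi]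
  constructor
  · rintro ⟨θ, rfl⟩; positivity
  · intro hξ
    refine ⟨Real.log (ξ / c), ?_⟩
    rw [Real.exp_log (by positivity)]
    field_simp

/-- The substitution `ξ = c e^θ`. -/
theorem integrableOn_Ioi_and_integral_comp_mul_exp {c : ℝ} (hc : 0 < c) {f : ℝ → ℂ}
    {F : ℝ → ℂ} (hF : Integrable F)
    (hfF : ∀ θ : ℝ, ((c * Real.exp θ : ℝ) : ℂ) * f (c * Real.exp θ) = F θ) :
    IntegrableOn f (Ioi 0) ∧ ∫ ξ in Ioi (0 : ℝ), f ξ = ∫ θ, F θ := by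
  have hd : ∀ θ ∈ (univ : Set ℝ), HasDerivWithinAt (fun θ : ℝ => c * Real.exp θ)
      (c * Real.exp θ) univ θ := fun θ _ =>
    ((Real.hasDerivAt_exp θ).const_mul c).hasDerivWithinAt
  have hinj : InjOn (fun θ : ℝ => c * Real.exp θ) univ := fun s _ t _ hst =>
    Real.exp_injective (mul_left_cancel₀ hc.ne' hst)
  have e : (fun θ : ℝ => |c * Real.exp θ| • f (c * Real.exp θ)) = F := by
    funext θ
    rw [abs_of_pos (by positivity), Complex.real_smul, hfF]
  have h1 := integrableOn_image_iff_integrableOn_abs_deriv_smul MeasurableSet.univ hd hinj f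
  have h2 := integral_image_eq_integral_abs_deriv_smul MeasurableSet.univ hd hinj f
  rw [image_mul_exp_univ hc] at h1 h2
  rw [e] at h1
  rw [h1, h2]
  simp only [integrableOn_univ, Measure.restrict_univ]
  exact ⟨hF, by rw [← e]⟩

theorem integrableOn_and_integral_whittakerKernel (a β : ℂ) {x y : ℝ} (hx : 0 < x) (hy : 0 < y) :
    IntegrableOn (fun ξ : ℝ => (ξ : ℂ) ^ β * whittakerKernel a x y ξ * whittakerWeight a ξ)
      (Ioi 0) ∧
    ∫ ξ in Ioi (0 : ℝ), (ξ : ℂ) ^ β * whittakerKernel a x y ξ * whittakerWeight a ξ =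
      ((x * y : ℝ) : ℂ) ^ β * confHypPsi β (1 - 2 * a + 2 * β) (x + y) := by
  obtain ⟨g, g', h⟩ := exists_isDecayingSolution (1 / 2 - a)
  have hP : 0 < x * y := by positivity
  have hS : 0 < x + y := by positivity
  have hP' : ((x * y : ℝ) : ℂ) ≠ 0 := by exact_mod_cast hP.ne'
  have hS' : ((x + y : ℝ) : ℂ) ≠ 0 := by exact_mod_cast hS.ne'
  have hc : 0 < x * y / (x + y) := by positivity
  set K : ℂ := ((2 * Real.sqrt Real.pi : ℝ) : ℂ)⁻¹ * ((x * y : ℝ) : ℂ) ^ a *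
    Complex.exp ((x + y : ℝ) : ℂ) * ((x * y / (x + y) : ℝ) : ℂ) ^ (β - a) with hK
  have hI := (h.isExpDecaying.integrable_mul_comp (m := fun θ : ℝ => Complex.exp ((β - a) * θ))
    (by fun_prop) (norm_cexp_ofReal_mul_le (β - a)) hS).const_mul K
  obtain ⟨h1, h2⟩ := integrableOn_Ioi_and_integral_comp_mul_exp hc (f := fun ξ : ℝ =>
    (ξ : ℂ) ^ β * whittakerKernel a x y ξ * whittakerWeight a ξ) hI (fun θ => by
      have hξ : 0 < x * y / (x + y) * Real.exp θ := by positivity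
      have hξ' : ((x * y / (x + y) * Real.exp θ : ℝ) : ℂ) ≠ 0 := by exact_mod_cast hξ.ne'
      rw [h.cpow_mul_whittakerKernel_mul_whittakerWeight β hx hy hξ]
      -- The constant c = xy/(x+y) is chosen so that xy + (x+y)ξ = xy(1 + e^θ); after squaring and
      -- dividing by 4xyξ only (x+y) cosh²(θ/2) is left.
      have ew : (x * y + x * (x * y / (x + y) * Real.exp θ) +
          y * (x * y / (x + y) * Real.exp θ)) ^ 2 /
            (4 * (x * y) * (x * y / (x + y) * Real.exp θ)) =
          (x + y) * Real.cosh (θ / 2) ^ 2 := by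
        have e1 : Real.exp θ = Real.exp (θ / 2) ^ 2 := by
          rw [← Real.exp_nat_mul]; congr 1; push_cast; ring
        have e2 := Real.exp_pos (θ / 2)
        rw [Real.cosh_eq, Real.exp_neg, e1]
        field_simp
        ring
      have ep : ((x * y / (x + y) * Real.exp θ : ℝ) : ℂ) ^ (β - a) =
          ((x * y / (x + y) : ℝ) : ℂ) ^ (β - a) * Complex.exp ((β - a) * θ) := by
        rw [Complex.ofReal_mul, Complex.mul_cpow_ofReal_nonneg hc.le (Real.exp_pos θ).le,
          Complex.cpow_def_of_ne_zero (x := ((Real.exp θ : ℝ) : ℂ))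
            (by exact_mod_cast (Real.exp_pos θ).ne'),
          ← Complex.ofReal_log (Real.exp_pos θ).le, Real.log_exp, mul_comm (θ : ℂ)]
      rw [ew, ep, hK]
      generalize ((x * y / (x + y) * Real.exp θ : ℝ) : ℂ) = ξ at hξ'
      field_simp)
  refine ⟨h1, h2.trans ?_⟩
  have eα : (1 - 2 * a + 2 * β) / 2 - β = 1 / 2 - a := by ring
  have eν : (1 - 2 * a + 2 * β) / 2 - 1 / 2 = β - a := by ring
  rw [integral_const_mul, confHypPsi, eα, eν, (h.isWhittakerW_integral (β - a)).whittakerW_eq hS,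
    hK]
  have e1 : ((x + y : ℝ) : ℂ) ^ (-(1 - 2 * a + 2 * β) / 2) * ((x + y : ℝ) : ℂ) ^ (1 / 2 : ℂ) =
      ((x + y : ℝ) : ℂ) ^ (-(β - a)) := by
    rw [← Complex.cpow_add _ _ hS']; congr 1; ring
  have e2 : Complex.exp (((x + y : ℝ) : ℂ) / 2) * Complex.exp (((x + y : ℝ) : ℂ) / 2) =
      Complex.exp ((x + y : ℝ) : ℂ) := by
    rw [← Complex.exp_add]; congr 1; ring
  have e3 : ((x * y : ℝ) : ℂ) ^ a * ((x * y / (x + y) : ℝ) : ℂ) ^ (β - a) =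
      ((x * y : ℝ) : ℂ) ^ β * ((x + y : ℝ) : ℂ) ^ (-(β - a)) := by
    rw [div_eq_mul_inv, Complex.ofReal_mul (x * y),
      Complex.mul_cpow_ofReal_nonneg hP.le (by positivity), ← mul_assoc,
      ← Complex.cpow_add _ _ hP', Complex.ofReal_inv, Complex.inv_cpow _ _ (by
        rw [Complex.arg_ofReal_of_nonneg hS.le]; exact Real.pi_pos.ne), Complex.cpow_neg]
    congr 2; ring
  generalize (∫ θ : ℝ, Complex.exp ((β - a) * θ) * g ((x + y) * Real.cosh (θ / 2) ^ 2)) = Φ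
  linear_combination (((2 * Real.sqrt Real.pi : ℝ) : ℂ)⁻¹ * Complex.exp ((x + y : ℝ) : ℂ) * Φ) * e3
    - ((x * y : ℝ) : ℂ) ^ β * ((2 * Real.sqrt Real.pi : ℝ) : ℂ)⁻¹ * Φ *
      (Complex.exp (((x + y : ℝ) : ℂ) / 2) * Complex.exp (((x + y : ℝ) : ℂ) / 2)) * e1
    - ((x * y : ℝ) : ℂ) ^ β * ((2 * Real.sqrt Real.pi : ℝ) : ℂ)⁻¹ * Φ *
      ((x + y : ℝ) : ℂ) ^ (-(β - a)) * e2

/-! ### The case β = 0. -/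

/-- The elementary Whittaker functions `x^p e^{-x/2}`. -/
theorem isWhittakerW_cpow_mul_exp {p ν : ℂ} (hν : p ^ 2 - p + 1 / 4 = ν ^ 2) :
    IsWhittakerW p ν fun x => (x : ℂ) ^ p * Complex.exp ((x : ℂ) / 2) * Complex.exp (-(x : ℂ)) := by
  have hd : ∀ x : ℝ, HasDerivAt (fun x : ℝ => Complex.exp (-(x : ℂ))) (-Complex.exp (-(x : ℂ))) x := by
    intro x
    have := (hasDerivAt_id (x : ℂ)).neg.cexp.comp_ofReal
    simpa using this
  refine isWhittakerW_cpow_mul_exp_mul (fun x _ => ⟨hd x, (hd x).neg, ?_⟩) ?_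
  · linear_combination Complex.exp (-(x : ℂ)) * hν
  · refine tendsto_const_nhds.congr fun x => ?_
    rw [sub_self, Complex.cpow_zero, mul_one, ← Complex.exp_add]
    simp

/-- For a = 0 the parameters p = b/2 and ν = b/2 - 1/2 satisfy (p - 1/2)² = ν², so W is elementary
and cancels the prefactor. -/
theorem confHypPsi_zero (b : ℂ) {x : ℝ} (hx : 0 < x) : confHypPsi 0 b x = 1 := by
  have hx' : (x : ℂ) ≠ 0 := by exact_mod_cast hx.ne'
  rw [confHypPsi, sub_zero, (isWhittakerW_cpow_mul_exp (by ring)).whittakerW_eq hx]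
  have e1 : (x : ℂ) ^ (-b / 2) * (x : ℂ) ^ (b / 2) = 1 := by
    rw [← Complex.cpow_add _ _ hx', neg_div, neg_add_cancel, Complex.cpow_zero]
  have e2 : Complex.exp ((x : ℂ) / 2) * Complex.exp ((x : ℂ) / 2) * Complex.exp (-(x : ℂ)) = 1 := by
    rw [← Complex.exp_add, ← Complex.exp_add, ← Complex.exp_zero]; congr 1; ring
  linear_combination (Complex.exp ((x : ℂ) / 2) * Complex.exp ((x : ℂ) / 2) *
    Complex.exp (-(x : ℂ))) * e1 + e2

theorem mainTheorem7 :
    (∀ (a β : ℂ) (x y : ℝ), 0 < x → 0 < y →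
      IntegrableOn (fun ξ : ℝ => (ξ : ℂ) ^ β * whittakerKernel a x y ξ * whittakerWeight a ξ)
        (Ioi 0) ∧
      ∫ ξ in Ioi (0 : ℝ), (ξ : ℂ) ^ β * whittakerKernel a x y ξ * whittakerWeight a ξ =
        ((x * y : ℝ) : ℂ) ^ β * confHypPsi β (1 - 2 * a + 2 * β) (x + y)) ∧
    (∀ (a : ℂ) (x y : ℝ), 0 < x → 0 < y →
      IntegrableOn (fun ξ : ℝ => whittakerKernel a x y ξ * whittakerWeight a ξ) (Ioi 0) ∧
      ∫ ξ in Ioi (0 : ℝ), whittakerKernel a x y ξ * whittakerWeight a ξ = 1) := by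
  refine ⟨fun a β x y hx hy => integrableOn_and_integral_whittakerKernel a β hx hy,
    fun a x y hx hy => ?_⟩
  have h := integrableOn_and_integral_whittakerKernel a 0 hx hy
  simpa only [Complex.cpow_zero, one_mul, confHypPsi_zero _ (add_pos hx hy)] using h
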